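/- **Definitions.** An *$\mathbf O$-category* is a category whose hom-sets are dcpos (posets in which every non-empty directed subset has a supremum) and whose composition is Scott-continuous. A functor between $\mathbf O$-categories is *locally continuous* if it acts Scott-continuously on hom-sets; $[\mathbf D\to\mathbf E]$ denotes the category of locally continuous functors $\mathbf D\to\mathbf E$ and all natural transformations; with the componentwise order it is again an $\mathbf O$-category, as is $\mathbf D\times\mathbf E$ with the product order. An embedding $e:X\to Y$ is a morphism with a (unique) $e^p:Y\to X$ such that $e^p e=\mathrm{id}_X$ and $e e^p\sqsubseteq \mathrm{id}_Y$. A cocone $\kappa:J\Rightarrow A$ of embeddings on an $\omega$-chain $J$ of embeddings is an *$\mathbf O$-colimit* if $(\kappa_n\kappa_n^p)_n$ is an ascending chain with supremum $\mathrm{id}_A$. An $\mathbf O$-category $\mathbf K$ *supports canonical fixed points* if it has an initial object $\bot$, it has zero morphisms and each $0_{XY}$ is the least element of $\mathbf K(X,Y)$, and every $\omega$-chain of embeddings has an $\mathbf O$-colimit. If $\mathbf C$ supports canonical fixed points, then so does $[\mathbf B\to\mathbf C]$ for every $\mathbf O$-category $\mathbf B$. **The dagger.** For each $\mathbf O$-category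 $\mathbf E$ that supports canonical fixed points, fix arbitrary choices of $\bot$ and of $\mathbf O$-colimits of $\omega$-chains of embeddings. For locally continuous $H:\mathbf E\to\mathbf E$ let $\mathsf{FIX}(H)$ be the chosen $\mathbf O$-colimit $\varphi^H$ of $\bot\to H\bot\to H^2\bot\to\cdots$, and for $\eta:H\Rightarrow H'$ let $\mathsf{FIX}(\eta)=\bigsqcup_n \varphi^{H'}_n\circ\eta^{(n)}_\bot\circ(\varphi^H_n)^p$, where $\eta^{(0)}=\mathrm{id}$ and $\eta^{(n+1)}=\eta\ast\eta^{(n)}$ (horizontal composition). For an $\mathbf O$-category $\mathbf D$ and a locally continuous $F:\mathbf D\times\mathbf E\to\mathbf E$ put $F^\dagger=\mathsf{FIX}\circ\Lambda F:\mathbf D\to\mathbf E$, where $\Lambda$ is currying, so $F^\dagger D=\mathsf{FIX}(F(D,-))$; similarly $\eta^\dagger=\mathsf{FIX}(\Lambda\eta)$ for $\eta:F\Rightarrow G$. This gives a functor $\dagger_{\mathbf D,\mathbf E}:[\mathbf D\times\mathbf E\to\mathbf E]\to[\mathbf D\to\mathbf E]$. **Theorem 1.** The dagger operation satisfies the Conway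 identities and the power identities up to natural isomorphism. That is, for all $\mathbf O$-categories $\mathbf P,\mathbf A,\mathbf B,\mathbf C$, where those at which a dagger is taken (namely $\mathbf C$ in 1, $\mathbf A$ and $\mathbf B$ in 2, $\mathbf B$ in 3, $\mathbf C$ in 4, $\mathbf B$ in 5) support canonical fixed points, and for all locally continuous functors $F,G$ of the indicated types: 1. (parameter) $(F\circ(G\times\mathrm{id}_{\mathbf C}))^\dagger\cong F^\dagger\circ G$ for $F:\mathbf B\times\mathbf C\to\mathbf C$ and $G:\mathbf A\to\mathbf B$; 2. (composition, parametrized dinaturality) $(G\circ\langle\pi_{\mathbf P},F\rangle)^\dagger\cong G\circ\langle\mathrm{id}_{\mathbf P},(F\circ\langle\pi_{\mathbf P},G\rangle)^\dagger\rangle$ for $F:\mathbf P\times\mathbf A\to\mathbf B$ and $G:\mathbf P\times\mathbf B\to\mathbf A$; 3. (double dagger) $(F^\dagger)^\dagger\cong(F\circ(\mathrm{id}_{\mathbf A}\times\langle\mathrm{id}_{\mathbf B},\mathrm{id}_{\mathbf B}\rangle))^\dagger$ for $F:\mathbf A\times\mathbf B\times\mathbf B\to\mathbf B$, the inner dagger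 being $\dagger_{\mathbf A\times\mathbf B,\mathbf B}$; 4. (abstraction) the two functors $[\mathbf A\times\mathbf B\times\mathbf C\to\mathbf C]\to[\mathbf A\to[\mathbf B\to\mathbf C]]$ given by $\Lambda\circ\dagger_{\mathbf A\times\mathbf B,\mathbf C}$ and by $\dagger_{\mathbf A,[\mathbf B\to\mathbf C]}\circ\Lambda\circ[\mathrm{id}_{\mathbf A}\times\langle\pi_{\mathbf B},\mathrm{ev}_{\mathbf B,\mathbf C}\rangle\to\mathrm{id}_{\mathbf C}]$ are naturally isomorphic; in particular $\Lambda(F^\dagger)\cong\bigl(\Lambda(F\circ(\mathrm{id}_{\mathbf A}\times\langle\pi_{\mathbf B},\mathrm{ev}_{\mathbf B,\mathbf C}\rangle))\bigr)^\dagger$ for each $F:\mathbf A\times\mathbf B\times\mathbf C\to\mathbf C$; 5. (power) $(F^n)^\dagger\cong F^\dagger$ for $F:\mathbf A\times\mathbf B\to\mathbf B$ and $n>1$, where $F^0=\pi_{\mathbf B}$ and $F^{n+1}=F\circ\langle\pi_{\mathbf A},F^n\rangle$. In particular this holds for all objects of $\mathbf{CFP}$, the 2-category of small $\mathbf O$-categories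 that support canonical fixed points, locally continuous functors and natural transformations. -/

import Mathlib

open CategoryTheory CategoryTheory.Limits

universe v₁ v₂ v₃ v₄ u₁ u₂ u₃ u₄

namespace OCat

/-! ### O-categories and locally continuous functors -/

/-- An O-category: a category whose hom-sets are dcpos (every nonempty directed subset has a
least upper bound) and whose composition is (Scott) continuous. -/
class OCategory (K : Type u₁) [Category.{v₁} K] where
  homOrder : ∀ X Y : K, PartialOrder (X ⟶ Y)
  exists_isLUB : ∀ {X Y : K} (d : Set (X ⟶ Y)), d.Nonempty → DirectedOn (· ≤ ·) d →
    ∃ f, IsLUB d f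
  continuous_comp : ∀ X Y Z : K,
    ScottContinuous (fun p : (X ⟶ Y) × (Y ⟶ Z) => p.1 ≫ p.2)

attribute [reducible, instance] OCategory.homOrder

section Basic

variable {K : Type u₁} [Category.{v₁} K] [OCategory K]

theorem comp_continuous {T : Type*} [Preorder T] {X Y Z : K} {f : T → (X ⟶ Y)}
    {g : T → (Y ⟶ Z)} (hf : ScottContinuous f) (hg : ScottContinuous g) :
    ScottContinuous (fun t => f t ≫ g t) :=
  (hf.prodMk hg).comp (OCategory.continuous_comp X Y Z)

theorem comp_le_comp {X Y Z : K} {f f' : X ⟶ Y} {g g' : Y ⟶ Z} (hf : f ≤ f') (hg : g ≤ g') :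
    f ≫ g ≤ f' ≫ g' :=
  (OCategory.continuous_comp X Y Z).monotone (show (f, g) ≤ (f', g') from ⟨hf, hg⟩)

theorem isLUB_range_comp {X Y Z : K} {a : ℕ → (X ⟶ Y)} (ha : Monotone a) {s : X ⟶ Y}
    (hs : IsLUB (Set.range a) s) (g : Y ⟶ Z) : IsLUB (Set.range fun n => a n ≫ g) (s ≫ g) := by
  have h := comp_continuous (K := K) (T := X ⟶ Y) ScottContinuous.id (ScottContinuous.const g)
    (Set.range_nonempty a) ha.directed_le.directedOn_range hs
  rw [← Set.range_comp] at h
  exact h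

theorem isLUB_range_precomp {X Y Z : K} {a : ℕ → (Y ⟶ Z)} (ha : Monotone a) {s : Y ⟶ Z}
    (hs : IsLUB (Set.range a) s) (g : X ⟶ Y) : IsLUB (Set.range fun n => g ≫ a n) (g ≫ s) := by
  have h := comp_continuous (K := K) (T := Y ⟶ Z) (ScottContinuous.const g) ScottContinuous.id
    (Set.range_nonempty a) ha.directed_le.directedOn_range hs
  rw [← Set.range_comp] at h
  exact h

end Basic

/-- A functor between O-categories is locally continuous if it acts continuously on hom-sets. -/
def LocallyContinuous {D : Type u₁} [Category.{v₁} D] [OCategory D] {E : Type u₂}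
    [Category.{v₂} E] [OCategory E] (F : D ⥤ E) : Prop :=
  ∀ X Y : D, ScottContinuous (fun f : X ⟶ Y => F.map f)

/-- Locally continuous functors `D ⥤ E`, the horizontal morphisms between O-categories. -/
structure LCFunctor (D : Type u₁) [Category.{v₁} D] [OCategory D] (E : Type u₂)
    [Category.{v₂} E] [OCategory E] extends D ⥤ E where
  lc : LocallyContinuous toFunctor

infixr:26 " ⥤ₒ " => LCFunctor

section FunctorCategory

variable {D : Type u₁} [Category.{v₁} D] [OCategory D] {E : Type u₂} [Category.{v₂} E]
  [OCategory E]

/-- The category of locally continuous functors, with all natural transformations. -/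
instance : Category (D ⥤ₒ E) where
  Hom F G := NatTrans F.toFunctor G.toFunctor
  id F := NatTrans.id F.toFunctor
  comp α β := NatTrans.vcomp α β

@[ext]
theorem LCFunctor.hom_ext {F G : D ⥤ₒ E} {α β : F ⟶ G} (h : ∀ X, α.app X = β.app X) : α = β :=
  NatTrans.ext (funext h)

@[simp] theorem LCFunctor.id_app (F : D ⥤ₒ E) (X : D) : NatTrans.app (𝟙 F) X = 𝟙 _ := rfl

@[simp] theorem LCFunctor.comp_app {F G H : D ⥤ₒ E} (α : F ⟶ G) (β : G ⟶ H) (X : D) :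
    NatTrans.app (α ≫ β) X = α.app X ≫ β.app X := rfl

/-- Natural transformations are ordered componentwise. -/
instance (F G : D ⥤ₒ E) : PartialOrder (F ⟶ G) :=
  PartialOrder.lift (fun α : F ⟶ G => fun X => NatTrans.app α X)
    (fun _ _ h => LCFunctor.hom_ext (congrFun h))

theorem LCFunctor.exists_lub {F G : D ⥤ₒ E} (d : Set (F ⟶ G)) (hne : d.Nonempty)
    (hd : DirectedOn (· ≤ ·) d) :
    ∃ α : F ⟶ G, ∀ X, IsLUB ((fun β : F ⟶ G => β.app X) '' d) (α.app X) := by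
  have hdX : ∀ X, DirectedOn (· ≤ ·) ((fun β : F ⟶ G => β.app X) '' d) := by
    rintro X _ ⟨a, ha, rfl⟩ _ ⟨b, hb, rfl⟩
    obtain ⟨c, hc, hac, hbc⟩ := hd a ha b hb
    exact ⟨_, ⟨c, hc, rfl⟩, hac X, hbc X⟩
  choose s hs using fun X => OCategory.exists_isLUB _ (hne.image fun β : F ⟶ G => β.app X) (hdX X)
  refine ⟨⟨s, fun X Y f => ?_⟩, hs⟩
  have h1 := comp_continuous (T := F.obj Y ⟶ G.obj Y) (ScottContinuous.const (F.map f))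
    ScottContinuous.id (hne.image _) (hdX Y) (hs Y)
  have h2 := comp_continuous (T := F.obj X ⟶ G.obj X) ScottContinuous.id
    (ScottContinuous.const (G.map f)) (hne.image _) (hdX X) (hs X)
  rw [Set.image_image] at h1 h2
  refine h1.unique ?_
  have h3 : (fun β : F ⟶ G => F.map f ≫ β.app Y) = fun β : F ⟶ G => β.app X ≫ G.map f :=
    funext fun β => β.naturality f
  exact h3 ▸ h2

theorem LCFunctor.isLUB_app {F G : D ⥤ₒ E} {d : Set (F ⟶ G)} (hne : d.Nonempty)
    (hd : DirectedOn (· ≤ ·) d) {α : F ⟶ G} (h : IsLUB d α) (X : D) :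
    IsLUB ((fun β : F ⟶ G => β.app X) '' d) (α.app X) := by
  obtain ⟨β, hβ⟩ := LCFunctor.exists_lub d hne hd
  have : IsLUB d β := ⟨fun γ hγ X => (hβ X).1 ⟨γ, hγ, rfl⟩, fun γ hγ X => (hβ X).2 (by
    rintro _ ⟨δ, hδ, rfl⟩
    exact hγ hδ X)⟩
  rw [h.unique this]
  exact hβ X

theorem LCFunctor.continuous_app (F G : D ⥤ₒ E) (X : D) :
    ScottContinuous (fun α : F ⟶ G => α.app X) :=
  fun _ hne hd _ h => LCFunctor.isLUB_app hne hd h X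

theorem LCFunctor.continuous_of_app {T : Type*} [Preorder T] {F G : D ⥤ₒ E} {a : T → (F ⟶ G)}
    (h : ∀ X, ScottContinuous fun t => (a t).app X) : ScottContinuous a := by
  intro d hne hd t ht
  refine ⟨?_, fun β hβ X => (h X hne hd ht).2 ?_⟩
  · rintro _ ⟨x, hx, rfl⟩ X
    exact (h X hne hd ht).1 ⟨x, hx, rfl⟩
  · rintro _ ⟨x, hx, rfl⟩
    exact hβ ⟨x, hx, rfl⟩ X

instance : OCategory (D ⥤ₒ E) where
  homOrder _ _ := inferInstance
  exists_isLUB d hne hd := by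
    obtain ⟨α, hα⟩ := LCFunctor.exists_lub d hne hd
    refine ⟨α, fun γ hγ X => (hα X).1 ⟨γ, hγ, rfl⟩, fun γ hγ X => (hα X).2 ?_⟩
    rintro _ ⟨δ, hδ, rfl⟩
    exact hγ hδ X
  continuous_comp F G H := LCFunctor.continuous_of_app fun X =>
    comp_continuous (ScottContinuous.fst.comp (LCFunctor.continuous_app F G X))
      (ScottContinuous.snd.comp (LCFunctor.continuous_app G H X))

end FunctorCategory

/-- The product of O-categories, with the product order on hom-sets. -/
instance {D : Type u₁} [Category.{v₁} D] [OCategory D] {E : Type u₂} [Category.{v₂} E]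
    [OCategory E] : OCategory (D × E) where
  homOrder X Y := inferInstanceAs (PartialOrder ((X.1 ⟶ Y.1) × (X.2 ⟶ Y.2)))
  exists_isLUB {X Y} d hne hd := by
    obtain ⟨f, hf⟩ := OCategory.exists_isLUB (Prod.fst '' d) (hne.image _) hd.fst
    obtain ⟨g, hg⟩ := OCategory.exists_isLUB (Prod.snd '' d) (hne.image _) hd.snd
    exact ⟨(f, g), isLUB_prod.2 ⟨hf, hg⟩⟩
  continuous_comp X Y Z := by
    let T := ((X.1 ⟶ Y.1) × (X.2 ⟶ Y.2)) × ((Y.1 ⟶ Z.1) × (Y.2 ⟶ Z.2))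
    have h1 : ScottContinuous (fun p : T => p.1.1 ≫ p.2.1) :=
      comp_continuous (ScottContinuous.fst.comp ScottContinuous.fst)
        (ScottContinuous.snd.comp ScottContinuous.fst)
    have h2 : ScottContinuous (fun p : T => p.1.2 ≫ p.2.2) :=
      comp_continuous (ScottContinuous.fst.comp ScottContinuous.snd)
        (ScottContinuous.snd.comp ScottContinuous.snd)
    exact h1.prodMk h2

/-! ### The cartesian closed structure on locally continuous functors -/

namespace LCFunctor

section Combinators

variable {A : Type u₁} [Category.{v₁} A] [OCategory A] {B : Type u₂} [Category.{v₂} B]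
  [OCategory B] {C : Type u₃} [Category.{v₃} C] [OCategory C] {D : Type u₄} [Category.{v₄} D]
  [OCategory D]

variable (A) in
/-- The identity functor. -/
def id : A ⥤ₒ A where
  toFunctor := 𝟭 A
  lc _ _ := ScottContinuous.id

/-- Composition `G ∘ F`, written in diagrammatic order. -/
def comp (F : A ⥤ₒ B) (G : B ⥤ₒ C) : A ⥤ₒ C where
  toFunctor := F.toFunctor ⋙ G.toFunctor
  lc X Y := (F.lc X Y).comp (G.lc _ _)

variable (A B) in
/-- The first projection. -/
def fst : A × B ⥤ₒ A where
  toFunctor := CategoryTheory.Prod.fst A B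
  lc _ _ := ScottContinuous.fst

variable (A B) in
/-- The second projection. -/
def snd : A × B ⥤ₒ B where
  toFunctor := CategoryTheory.Prod.snd A B
  lc _ _ := ScottContinuous.snd

/-- The pairing `⟨F, G⟩`. -/
def pair (F : A ⥤ₒ B) (G : A ⥤ₒ C) : A ⥤ₒ B × C where
  toFunctor := F.toFunctor.prod' G.toFunctor
  lc X Y := (F.lc X Y).prodMk (G.lc X Y)

/-- The product `F × G` of two functors. -/
def prodMap (F : A ⥤ₒ B) (G : C ⥤ₒ D) : A × C ⥤ₒ B × D :=
  pair ((fst A C).comp F) ((snd A C).comp G)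

variable (A B C) in
/-- The canonical isomorphism `(A × B) × C ⥤ A × (B × C)`. -/
def assoc : (A × B) × C ⥤ₒ A × (B × C) :=
  pair ((fst (A × B) C).comp (fst A B)) (pair ((fst (A × B) C).comp (snd A B)) (snd (A × B) C))

variable (A B) in
/-- Evaluation `(F, X) ↦ F X`. -/
def ev : (A ⥤ₒ B) × A ⥤ₒ B where
  obj p := p.1.obj p.2
  map {p q} f := p.1.map f.2 ≫ f.1.app q.2
  map_id p := by
    change p.1.map (𝟙 p.2) ≫ 𝟙 _ = _
    simp
  map_comp {p q r} f g := by
    change p.1.map (f.2 ≫ g.2) ≫ (f.1.app r.2 ≫ g.1.app r.2) = _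
    have := f.1.naturality g.2
    simp only [Functor.map_comp, Category.assoc]
    rw [← Category.assoc (p.1.map g.2), this, Category.assoc]
  lc p q := comp_continuous (ScottContinuous.snd.comp (p.1.lc _ _))
    (ScottContinuous.fst.comp (continuous_app p.1 q.1 q.2))

/-- The partial application `F(X, -)`. -/
def partialApp (F : A × B ⥤ₒ C) (X : A) : B ⥤ₒ C where
  obj Y := F.obj (X, Y)
  map g := F.map (Prod.mkHom (𝟙 X) g)
  map_id Y := F.map_id (X, Y)
  map_comp f g := by
    rw [← F.map_comp]
    congr 1
    simp
  lc _ _ := ((ScottContinuous.const (𝟙 X)).prodMk ScottContinuous.id).comp (F.lc _ _)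

/-- The abstraction `Λ F : X ↦ F(X, -)`. -/
def curry (F : A × B ⥤ₒ C) : A ⥤ₒ (B ⥤ₒ C) where
  obj X := F.partialApp X
  map {X X'} f :=
    { app := fun Y => F.map (Prod.mkHom f (𝟙 Y))
      naturality := fun Y Y' g => by
        dsimp only [partialApp]
        rw [← F.map_comp, ← F.map_comp]
        congr 1
        simp }
  map_id X := hom_ext fun Y => F.map_id (X, Y)
  map_comp {X X' X''} f g := hom_ext fun Y => by
    have h : Prod.mkHom (f ≫ g) (𝟙 Y) = Prod.mkHom f (𝟙 Y) ≫ Prod.mkHom g (𝟙 Y) := by simp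
    exact (congrArg (fun k => F.map k) h).trans (F.map_comp _ _)
  lc _ _ := continuous_of_app fun Y =>
    (ScottContinuous.id.prodMk (ScottContinuous.const (𝟙 Y))).comp (F.lc _ _)

variable (A B C) in
/-- The abstraction functor `Λ`, with its action on natural transformations. -/
def curryFunctor : (A × B ⥤ₒ C) ⥤ (A ⥤ₒ (B ⥤ₒ C)) where
  obj F := F.curry
  map α :=
    { app := fun X =>
        { app := fun Y => α.app (X, Y)
          naturality := fun _ _ g => α.naturality (Prod.mkHom (𝟙 X) g) }
      naturality := fun _ _ f => hom_ext fun Y => α.naturality (Prod.mkHom f (𝟙 Y)) }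
  map_id _ := rfl
  map_comp _ _ := rfl

variable (C) in
/-- Precomposition `[G → id] : H ↦ H ∘ G`, with its action on natural transformations. -/
def precomp (G : A ⥤ₒ B) : (B ⥤ₒ C) ⥤ (A ⥤ₒ C) where
  obj H := G.comp H
  map α :=
    { app := fun X => α.app (G.obj X)
      naturality := fun _ _ f => α.naturality (G.map f) }
  map_id _ := rfl
  map_comp _ _ := rfl

variable (A) in
/-- Postcomposition `[id → H] : G ↦ H ∘ G`, with its action on natural transformations. -/
def postcomp (H : B ⥤ₒ C) : (A ⥤ₒ B) ⥤ (A ⥤ₒ C) where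
  obj G := G.comp H
  map {G G'} α :=
    { app := fun X => H.map (α.app X)
      naturality := fun X Y f => by
        have h := congrArg (fun k => H.map k) (α.naturality f)
        exact (H.map_comp _ _).symm.trans (h.trans (H.map_comp _ _)) }
  map_id G := hom_ext fun X => H.map_id _
  map_comp α β := hom_ext fun X => H.map_comp _ _

/-- The powers `F⁰ = π₂` and `Fⁿ⁺¹ = F ∘ ⟨π₁, Fⁿ⟩` of `F : A × B ⥤ B`. -/
def power (F : A × B ⥤ₒ B) : ℕ → (A × B ⥤ₒ B)
  | 0 => snd A B
  | n + 1 => (pair (fst A B) (F.power n)).comp F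

end Combinators

end LCFunctor

/-! ### Embeddings, O-colimits, canonical fixed points -/

section Embeddings

variable {K : Type u₁} [Category.{v₁} K] [OCategory K]

/-- `(e, p)` is an embedding-projection pair. -/
def IsEPPair {X Y : K} (e : X ⟶ Y) (p : Y ⟶ X) : Prop :=
  e ≫ p = 𝟙 X ∧ p ≫ e ≤ 𝟙 Y

/-- `e` is an embedding. -/
def IsEmbedding {X Y : K} (e : X ⟶ Y) : Prop :=
  ∃ p, IsEPPair e p

theorem IsEPPair.comp {X Y Z : K} {e : X ⟶ Y} {p : Y ⟶ X} {e' : Y ⟶ Z} {p' : Z ⟶ Y}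
    (h : IsEPPair e p) (h' : IsEPPair e' p') : IsEPPair (e ≫ e') (p' ≫ p) := by
  refine ⟨?_, ?_⟩
  · rw [Category.assoc, ← Category.assoc e', h'.1, Category.id_comp, h.1]
  · calc (p' ≫ p) ≫ e ≫ e' = p' ≫ (p ≫ e) ≫ e' := by simp only [Category.assoc]
      _ ≤ p' ≫ 𝟙 _ ≫ e' := comp_le_comp le_rfl (comp_le_comp h.2 le_rfl)
      _ ≤ 𝟙 _ := by rw [Category.id_comp]; exact h'.2

theorem IsEmbedding.id (X : K) : IsEmbedding (𝟙 X) :=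
  ⟨𝟙 X, Category.id_comp _, (Category.id_comp _).le⟩

theorem IsEmbedding.comp {X Y Z : K} {e : X ⟶ Y} {e' : Y ⟶ Z} (h : IsEmbedding e)
    (h' : IsEmbedding e') : IsEmbedding (e ≫ e') := by
  obtain ⟨p, hp⟩ := h
  obtain ⟨p', hp'⟩ := h'
  exact ⟨_, hp.comp hp'⟩

theorem IsEPPair.proj_unique {X Y : K} {e : X ⟶ Y} {p q : Y ⟶ X} (hp : IsEPPair e p)
    (hq : IsEPPair e q) : p = q := by
  have key : ∀ {p q : Y ⟶ X}, IsEPPair e p → IsEPPair e q → p ≤ q := by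
    intro p q hp hq
    calc p = p ≫ e ≫ q := by rw [hq.1, Category.comp_id]
      _ = (p ≫ e) ≫ q := by rw [Category.assoc]
      _ ≤ 𝟙 _ ≫ q := comp_le_comp hp.2 le_rfl
      _ = q := Category.id_comp _
  exact le_antisymm (key hp hq) (key hq hp)

theorem LCFunctor.map_isEPPair {L : Type u₂} [Category.{v₂} L] [OCategory L] (F : K ⥤ₒ L)
    {X Y : K} {e : X ⟶ Y} {p : Y ⟶ X} (h : IsEPPair e p) : IsEPPair (F.map e) (F.map p) := by
  refine ⟨by rw [← F.map_comp, h.1, F.map_id], ?_⟩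
  rw [← F.map_comp, ← F.map_id]
  exact (F.lc _ _).monotone h.2

theorem LCFunctor.map_isEmbedding {L : Type u₂} [Category.{v₂} L] [OCategory L] (F : K ⥤ₒ L)
    {X Y : K} {e : X ⟶ Y} (h : IsEmbedding e) : IsEmbedding (F.map e) :=
  let ⟨p, hp⟩ := h
  ⟨F.map p, F.map_isEPPair hp⟩

/-- An `ω`-chain all of whose morphisms are embeddings, i.e. an `ω`-chain in `Kᵉ`. -/
def IsEmbeddingChain (J : ℕ ⥤ K) : Prop :=
  ∀ ⦃m n : ℕ⦄ (f : m ⟶ n), IsEmbedding (J.map f)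

/-- The cocone `κ` consists of embeddings and is an O-colimit: the idempotents `κₙ ∘ κₙᵖ` form an
ascending chain with supremum the identity (the projections `κₙᵖ` are unique). -/
def IsOColimit {J : ℕ ⥤ K} (c : Cocone J) : Prop :=
  ∃ p : ∀ n : ℕ, c.pt ⟶ J.obj n, (∀ n, IsEPPair (c.ι.app n) (p n)) ∧
    Monotone (fun n => p n ≫ c.ι.app n) ∧ IsLUB (Set.range fun n => p n ≫ c.ι.app n) (𝟙 c.pt)

variable (K) in
/-- Every `ω`-chain of embeddings has an O-colimit. -/
def OCocomplete : Prop :=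
  ∀ J : ℕ ⥤ K, IsEmbeddingChain J → ∃ c : Cocone J, IsOColimit c

variable (K) in
/-- `K` has zero morphisms, and they are the least elements of the hom-sets. -/
def HasStrictMorphisms : Prop :=
  ∃ _ : HasZeroMorphisms K, ∀ (X Y : K) (f : X ⟶ Y), (0 : X ⟶ Y) ≤ f

variable (K) in
/-- `K` supports canonical fixed points. -/
class SupportsCanonicalFixedPoints : Prop where
  hasInitial : HasInitial K
  strict : HasStrictMorphisms K
  cocomplete : OCocomplete K

variable (K) in
/-- A choice of an initial object and of an O-colimit for each `ω`-chain of embeddings. -/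
structure FixChoice where
  bot : K
  isInitial : IsInitial bot
  colim : ∀ J : ℕ ⥤ K, IsEmbeddingChain J → Cocone J
  isOColimit : ∀ (J : ℕ ⥤ K) (hJ : IsEmbeddingChain J), IsOColimit (colim J hJ)

/-- Such a choice exists. -/
theorem FixChoice.nonempty [h : SupportsCanonicalFixedPoints K] : Nonempty (FixChoice K) := by
  have := h.hasInitial
  choose c hc using h.cocomplete
  exact ⟨⟨⊥_ K, initialIsInitial, c, hc⟩⟩

namespace IsOColimit

variable {J : ℕ ⥤ K} {c : Cocone J} (hc : IsOColimit c)

/-- The projection `κₙᵖ`. -/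
noncomputable def proj (n : ℕ) : c.pt ⟶ J.obj n := hc.choose n

theorem proj_isEPPair (n : ℕ) : IsEPPair (c.ι.app n) (hc.proj n) := hc.choose_spec.1 n

theorem monotone_proj : Monotone (fun n => hc.proj n ≫ c.ι.app n) := hc.choose_spec.2.1

theorem isLUB_proj : IsLUB (Set.range fun n => hc.proj n ≫ c.ι.app n) (𝟙 c.pt) :=
  hc.choose_spec.2.2

theorem proj_comp_le {m n : ℕ} (f : m ⟶ n) : hc.proj m ≫ J.map f ≤ hc.proj n := by
  calc hc.proj m ≫ J.map f = (hc.proj m ≫ J.map f) ≫ c.ι.app n ≫ hc.proj n := by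
        rw [(hc.proj_isEPPair n).1, Category.comp_id]
    _ = (hc.proj m ≫ c.ι.app m) ≫ hc.proj n := by
        rw [← c.w f]; simp only [Category.assoc]
    _ ≤ 𝟙 _ ≫ hc.proj n := comp_le_comp (hc.proj_isEPPair m).2 le_rfl
    _ = hc.proj n := Category.id_comp _

variable {A : K}

theorem monotone_med (s : J ⟶ (Functor.const ℕ).obj A) :
    Monotone (fun n => hc.proj n ≫ (s.app n : J.obj n ⟶ A)) := by
  intro m n hmn
  have h : (s.app m : J.obj m ⟶ A) = J.map (homOfLE hmn) ≫ s.app n := by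
    simp
  dsimp only
  rw [h, ← Category.assoc]
  exact comp_le_comp (hc.proj_comp_le _) le_rfl

theorem exists_med (s : J ⟶ (Functor.const ℕ).obj A) :
    ∃ θ : c.pt ⟶ A, IsLUB (Set.range fun n => hc.proj n ≫ (s.app n : J.obj n ⟶ A)) θ :=
  OCategory.exists_isLUB _ (Set.range_nonempty _)
    (hc.monotone_med s).directed_le.directedOn_range

/-- The mediating morphism `⨆ₙ sₙ ∘ κₙᵖ` from an O-colimit `κ` to a cocone `s`. -/
noncomputable def med (s : J ⟶ (Functor.const ℕ).obj A) : c.pt ⟶ A := (hc.exists_med s).choose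

theorem isLUB_med (s : J ⟶ (Functor.const ℕ).obj A) :
    IsLUB (Set.range fun n => hc.proj n ≫ (s.app n : J.obj n ⟶ A)) (hc.med s) :=
  (hc.exists_med s).choose_spec

theorem fac (s : J ⟶ (Functor.const ℕ).obj A) (n : ℕ) : c.ι.app n ≫ hc.med s = s.app n := by
  refine (isLUB_range_precomp (hc.monotone_med s) (hc.isLUB_med s) (c.ι.app n)).unique
    (IsGreatest.isLUB ⟨⟨n, ?_⟩, ?_⟩)
  · dsimp only
    rw [← Category.assoc, (hc.proj_isEPPair n).1]
    exact Category.id_comp _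
  · rintro _ ⟨m, rfl⟩
    have hs : ∀ {i : ℕ} (h : i ≤ max n m), (s.app i : J.obj i ⟶ A) =
        J.map (homOfLE h) ≫ s.app (max n m) := fun h => by
      simp
    have hn := hs (le_max_left n m)
    have hm := hs (le_max_right n m)
    have hw := c.w (homOfLE (le_max_left n m))
    calc c.ι.app n ≫ hc.proj m ≫ (s.app m : J.obj m ⟶ A)
        = J.map (homOfLE (le_max_left n m)) ≫ c.ι.app (max n m) ≫
          (hc.proj m ≫ J.map (homOfLE (le_max_right n m))) ≫ s.app (max n m) := by
          rw [hm, ← hw]; simp only [Category.assoc]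
      _ ≤ J.map (homOfLE (le_max_left n m)) ≫ c.ι.app (max n m) ≫
          hc.proj (max n m) ≫ s.app (max n m) :=
          comp_le_comp le_rfl (comp_le_comp le_rfl
            (comp_le_comp (hc.proj_comp_le _) le_rfl))
      _ = s.app n := by
          rw [hn, ← Category.assoc (c.ι.app _), (hc.proj_isEPPair _).1]
          congr 1
          exact Category.id_comp _

theorem hom_ext (hc : IsOColimit c) {f g : c.pt ⟶ A} (h : ∀ n, c.ι.app n ≫ f = c.ι.app n ≫ g) : f = g := by
  have hf := isLUB_range_comp hc.monotone_proj hc.isLUB_proj f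
  have hg := isLUB_range_comp hc.monotone_proj hc.isLUB_proj g
  simp only [Category.assoc, h, Category.id_comp] at hf hg
  exact hf.unique hg

theorem continuous_med {T : Type*} [Preorder T] {a : T → (J ⟶ (Functor.const ℕ).obj A)}
    (h : ∀ n, ScottContinuous fun t => ((a t).app n : J.obj n ⟶ A)) :
    ScottContinuous fun t => hc.med (a t) := by
  intro d hne hd t ht
  refine ⟨?_, fun b hb => (hc.isLUB_med (a t)).2 ?_⟩
  · rintro _ ⟨x, hx, rfl⟩
    refine (hc.isLUB_med (a x)).2 ?_
    rintro _ ⟨n, rfl⟩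
    exact (comp_le_comp le_rfl ((h n).monotone (ht.1 hx))).trans
      ((hc.isLUB_med (a t)).1 ⟨n, rfl⟩)
  · rintro _ ⟨n, rfl⟩
    refine (comp_continuous (ScottContinuous.const (hc.proj n)) (h n) hne hd ht).2 ?_
    rintro _ ⟨x, hx, rfl⟩
    exact ((hc.isLUB_med (a x)).1 ⟨n, rfl⟩).trans (hb ⟨x, hx, rfl⟩)

/-- The action `⨆ₙ κ'ₙ ∘ αₙ ∘ κₙᵖ` of taking O-colimits on a morphism `α` of chains. -/
noncomputable def map {J' : ℕ ⥤ K} (c' : Cocone J') (α : J ⟶ J') : c.pt ⟶ c'.pt :=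
  hc.med (α ≫ c'.ι)

theorem ι_map {J' : ℕ ⥤ K} (c' : Cocone J') (α : J ⟶ J') (n : ℕ) :
    c.ι.app n ≫ hc.map c' α = α.app n ≫ c'.ι.app n :=
  hc.fac _ n

theorem map_id : hc.map c (𝟙 J) = 𝟙 c.pt :=
  hc.hom_ext fun n => by simp [ι_map]

theorem map_comp {J' J'' : ℕ ⥤ K} {c' : Cocone J'} (hc' : IsOColimit c') (c'' : Cocone J'')
    (α : J ⟶ J') (β : J' ⟶ J'') : hc.map c'' (α ≫ β) = hc.map c' α ≫ hc'.map c'' β :=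
  hc.hom_ext fun n => by
    rw [ι_map, ← Category.assoc, ι_map, Category.assoc, ι_map, NatTrans.comp_app, Category.assoc]

theorem continuous_map {T : Type*} [Preorder T] {J' : ℕ ⥤ K} (c' : Cocone J') {a : T → (J ⟶ J')}
    (h : ∀ n, ScottContinuous fun t => (a t).app n) : ScottContinuous fun t => hc.map c' (a t) :=
  hc.continuous_med fun n => comp_continuous (h n) (ScottContinuous.const (c'.ι.app n))

end IsOColimit

/-! ### The dagger operation -/

theorem isEmbeddingChain_ofSequence {X : ℕ → K} (f : ∀ n, X n ⟶ X (n + 1))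
    (hf : ∀ n, IsEmbedding (f n)) : IsEmbeddingChain (Functor.ofSequence f) := by
  intro m n g
  obtain ⟨k, rfl⟩ := Nat.exists_eq_add_of_le (leOfHom g)
  obtain rfl := Subsingleton.elim g (homOfLE (by lia))
  induction k with
  | zero =>
    have : (homOfLE (Nat.le_add_right m 0) : m ⟶ m + 0) = 𝟙 m := rfl
    rw [this, CategoryTheory.Functor.map_id]
    exact IsEmbedding.id _
  | succ k ih =>
    have : (homOfLE (Nat.le_add_right m (k + 1)) : m ⟶ m + (k + 1)) =
      homOfLE (Nat.le_add_right m k) ≫ homOfLE (Nat.le_add_right (m + k) 1) := rfl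
    rw [this, Functor.map_comp, Functor.ofSequence_map_homOfLE_succ]
    exact ih.comp (hf _)

theorem isEmbedding_of_isInitial (hK : HasStrictMorphisms K) {X : K} (hX : IsInitial X) {Y : K}
    (f : X ⟶ Y) : IsEmbedding f := by
  obtain ⟨_, h0⟩ := hK
  refine ⟨0, hX.hom_ext _ _, ?_⟩
  rw [zero_comp]
  exact h0 _ _ _

namespace FixChoice

variable (c : FixChoice K)

/-- The iterates `Fⁿ ⊥`. -/
def iter (F : K ⥤ₒ K) : ℕ → K
  | 0 => c.bot
  | n + 1 => F.obj (iter F n)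

/-- The links `Fⁿ(⊥ → F ⊥)`. -/
def link (F : K ⥤ₒ K) : ∀ n, c.iter F n ⟶ c.iter F (n + 1)
  | 0 => c.isInitial.to _
  | n + 1 => F.map (link F n)

/-- The `ω`-chain `⊥ → F ⊥ → F² ⊥ → ⋯`. -/
def chain (F : K ⥤ₒ K) : ℕ ⥤ K := Functor.ofSequence (c.link F)

/-- The components `η⁽ⁿ⁾ : Fⁿ ⊥ → Gⁿ ⊥` of the horizontal iterates of `η`. -/
def iterMap {F G : K ⥤ₒ K} (η : F ⟶ G) : ∀ n, c.iter F n ⟶ c.iter G n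
  | 0 => 𝟙 _
  | n + 1 => F.map (iterMap η n) ≫ η.app (c.iter G n)

theorem link_iterMap {F G : K ⥤ₒ K} (η : F ⟶ G) (n : ℕ) :
    c.link F n ≫ c.iterMap η (n + 1) = c.iterMap η n ≫ c.link G n := by
  induction n with
  | zero => exact c.isInitial.hom_ext _ _
  | succ n ih =>
    have h := congrArg (fun k => F.map k) ih
    simp only [Functor.map_comp] at h
    calc F.map (c.link F n) ≫ F.map (c.iterMap η (n + 1)) ≫ η.app (c.iter G (n + 1))
        = F.map (c.iterMap η n) ≫ F.map (c.link G n) ≫ η.app (c.iter G (n + 1)) := by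
          rw [← Category.assoc, h, Category.assoc]
      _ = F.map (c.iterMap η n) ≫ η.app (c.iter G n) ≫ G.map (c.link G n) := by
          congr 1
          exact η.naturality _
      _ = (F.map (c.iterMap η n) ≫ η.app (c.iter G n)) ≫ G.map (c.link G n) :=
          (Category.assoc _ _ _).symm

/-- The morphism of chains induced by a natural transformation. -/
def chainMap {F G : K ⥤ₒ K} (η : F ⟶ G) : c.chain F ⟶ c.chain G :=
  NatTrans.ofSequence (c.iterMap η) fun n => by
    simp only [chain, Functor.ofSequence_map_homOfLE_succ]
    exact c.link_iterMap η n

theorem chainMap_id (F : K ⥤ₒ K) : c.chainMap (𝟙 F) = 𝟙 _ := by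
  ext n
  change c.iterMap (𝟙 F) n = 𝟙 (c.iter F n)
  induction n with
  | zero => rfl
  | succ n ih =>
    change F.map _ ≫ 𝟙 _ = 𝟙 (F.obj _)
    rw [ih, F.map_id, Category.comp_id]

theorem chainMap_comp {F G H : K ⥤ₒ K} (η : F ⟶ G) (ρ : G ⟶ H) :
    c.chainMap (η ≫ ρ) = c.chainMap η ≫ c.chainMap ρ := by
  ext n
  change c.iterMap (η ≫ ρ) n = c.iterMap η n ≫ c.iterMap ρ n
  induction n with
  | zero => exact (Category.id_comp _).symm
  | succ n ih =>
    change F.map _ ≫ η.app _ ≫ ρ.app _ = (F.map _ ≫ η.app _) ≫ G.map _ ≫ ρ.app _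
    rw [ih, F.map_comp, Category.assoc, Category.assoc]
    congr 1
    rw [← Category.assoc, ← Category.assoc]
    congr 1
    exact η.naturality _

theorem continuous_iterMap (F G : K ⥤ₒ K) (n : ℕ) :
    ScottContinuous fun η : F ⟶ G => c.iterMap η n := by
  induction n with
  | zero => exact ScottContinuous.const _
  | succ n ih => exact comp_continuous (ih.comp (F.lc _ _)) (LCFunctor.continuous_app F G _)

variable [hK : SupportsCanonicalFixedPoints K]

theorem isEmbeddingChain_chain (F : K ⥤ₒ K) : IsEmbeddingChain (c.chain F) := by
  refine isEmbeddingChain_ofSequence _ fun n => ?_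
  induction n with
  | zero => exact isEmbedding_of_isInitial hK.strict c.isInitial _
  | succ n ih => exact F.map_isEmbedding ih

/-- The chosen O-colimit of `⊥ → F ⊥ → F² ⊥ → ⋯`. -/
def fixCocone (F : K ⥤ₒ K) : Cocone (c.chain F) := c.colim _ (c.isEmbeddingChain_chain F)

theorem isOColimit_fixCocone (F : K ⥤ₒ K) : IsOColimit (c.fixCocone F) := c.isOColimit _ _

/-- The canonical-fixed-point functor `FIX`: on objects the chosen O-colimit of
`⊥ → F ⊥ → F² ⊥ → ⋯`, on natural transformations `⨆ₙ γₙ ∘ η⁽ⁿ⁾ ∘ φₙᵖ`. -/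
noncomputable def FIX : (K ⥤ₒ K) ⥤ₒ K where
  obj F := (c.fixCocone F).pt
  map {F G} η := (c.isOColimit_fixCocone F).map (c.fixCocone G) (c.chainMap η)
  map_id F := by rw [chainMap_id, IsOColimit.map_id]
  map_comp {F G H} η ρ := by
    rw [chainMap_comp, (c.isOColimit_fixCocone F).map_comp (c.isOColimit_fixCocone G)]
  lc F G := (c.isOColimit_fixCocone F).continuous_map _ (c.continuous_iterMap F G)

/-- The dagger functor `F ↦ F†`, `F† X = FIX (F(X, -))`, with its action on natural
transformations. -/
noncomputable def daggerFunctor (D : Type u₂) [Category.{v₂} D] [OCategory D] :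
    (D × K ⥤ₒ K) ⥤ (D ⥤ₒ K) :=
  LCFunctor.curryFunctor D K K ⋙ LCFunctor.postcomp D c.FIX

/-- The dagger `F† : D ⥤ K` of a locally continuous functor `F : D × K ⥤ K`. -/
noncomputable def dagger {D : Type u₂} [Category.{v₂} D] [OCategory D] (F : D × K ⥤ₒ K) :
    D ⥤ₒ K :=
  (c.daggerFunctor D).obj F

end FixChoice

end Embeddings

/-! ### Functor categories support canonical fixed points -/

section FunctorCFP

variable {B : Type u₁} [Category.{v₁} B] [OCategory B] {C : Type u₂} [Category.{v₂} C]
  [OCategory C]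

/-- The constant functor. -/
def LCFunctor.const (X : C) : B ⥤ₒ C where
  toFunctor := (Functor.const B).obj X
  lc _ _ := ScottContinuous.const _

/-- Evaluation of functors at a fixed object. -/
def LCFunctor.evalAt (C : Type u₂) [Category.{v₂} C] [OCategory C] (X : B) : (B ⥤ₒ C) ⥤ C where
  obj F := F.obj X
  map α := α.app X

/-- The morphism between the evaluations of a chain of functors at two objects. -/
def LCFunctor.evalMap (J : ℕ ⥤ (B ⥤ₒ C)) {X Y : B} (f : X ⟶ Y) :
    J ⋙ LCFunctor.evalAt C X ⟶ J ⋙ LCFunctor.evalAt C Y where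
  app n := (J.obj n).map f
  naturality _ _ g := ((J.map g).naturality f).symm

theorem LCFunctor.isEPPair_app {F G : B ⥤ₒ C} {e : F ⟶ G} {p : G ⟶ F} (h : IsEPPair e p) (X : B) :
    IsEPPair (e.app X) (p.app X) :=
  ⟨congrArg (fun α : F ⟶ F => α.app X) h.1, h.2 X⟩

theorem hasInitial_lcFunctor (h : HasInitial C) : HasInitial (B ⥤ₒ C) := by
  refine (IsInitial.ofUniqueHom (X := (LCFunctor.const (⊥_ C) : B ⥤ₒ C))
    (fun F => NatTrans.mk (fun X => initial.to (F.obj X))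
      fun _ _ _ => initialIsInitial.hom_ext _ _)
    (fun F α => LCFunctor.hom_ext fun X => initialIsInitial.hom_ext _ _)).hasInitial

theorem strict_lcFunctor (h : HasStrictMorphisms C) : HasStrictMorphisms (B ⥤ₒ C) := by
  obtain ⟨_, h0⟩ := h
  refine ⟨{ zero := fun F G => ⟨⟨fun X => 0, fun _ _ _ => by simp⟩⟩
            comp_zero := fun α H => LCFunctor.hom_ext fun X => comp_zero
            zero_comp := fun F {G H} α => LCFunctor.hom_ext fun X => zero_comp },
    fun F G α X => h0 _ _ _⟩

theorem oCocomplete_lcFunctor (h : OCocomplete C) : OCocomplete (B ⥤ₒ C) := by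
  intro J hJ
  have hJX : ∀ X : B, IsEmbeddingChain (J ⋙ LCFunctor.evalAt C X) := fun X m n f => by
    obtain ⟨p, hp⟩ := hJ f
    exact ⟨_, LCFunctor.isEPPair_app hp X⟩
  choose c hc using fun X : B => h _ (hJX X)
  let L : B ⥤ₒ C :=
    { obj := fun X => (c X).pt
      map := fun {X Y} f => (hc X).map (c Y) (LCFunctor.evalMap J f)
      map_id := fun X => by
        rw [← (hc X).map_id]
        congr 1
        ext n
        exact (J.obj n).map_id X
      map_comp := fun {X Y Z} f g => by
        rw [← (hc X).map_comp (hc Y)]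
        congr 1
        ext n
        exact (J.obj n).map_comp f g
      lc := fun X Y => (hc X).continuous_map _ fun n => (J.obj n).lc X Y }
  let κ : Cocone J :=
    { pt := L
      ι :=
        { app := fun n => ⟨fun X => (c X).ι.app n, fun X Y f => ((hc X).ι_map (c Y) (LCFunctor.evalMap J f) n).symm⟩
          naturality := fun m n f => LCFunctor.hom_ext fun X => (c X).ι.naturality f } }
  have hproj : ∀ (X : B) {m n : ℕ} (f : n ⟶ m) (q : J.obj m ⟶ J.obj n), IsEPPair (J.map f) q →
      (c X).ι.app m ≫ (hc X).proj n = (LCFunctor.evalAt C X).map q := by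
    intro X m n f q hq
    have h1 : IsEPPair ((c X).ι.app n) ((hc X).proj m ≫ (LCFunctor.evalAt C X).map q) := by
      have := (LCFunctor.isEPPair_app hq X).comp ((hc X).proj_isEPPair m)
      have hw : (J.map f).app X ≫ (c X).ι.app m = (c X).ι.app n := (c X).w f
      rwa [hw] at this
    rw [((hc X).proj_isEPPair n).proj_unique h1, ← Category.assoc, ((hc X).proj_isEPPair m).1]
    exact Category.id_comp _
  let p : ∀ n, L ⟶ J.obj n := fun n =>
    { app := fun X => (hc X).proj n
      naturality := fun X Y f => by
        refine (hc X).hom_ext fun m => ?_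
        have key : ∀ {k : ℕ}, n ≤ k → (c X).ι.app k ≫ (hc X).map (c Y) (LCFunctor.evalMap J f) ≫
            (hc Y).proj n = (c X).ι.app k ≫ (hc X).proj n ≫ (J.obj n).map f := by
          intro k hk
          obtain ⟨q, hq⟩ := hJ (homOfLE hk)
          have h1 : (c X).ι.app k ≫ (hc X).proj n ≫ (J.obj n).map f =
              (LCFunctor.evalAt C X).map q ≫ (J.obj n).map f := by
            rw [← hproj X _ q hq]
            exact (Category.assoc _ _ _).symm
          rw [h1, ← Category.assoc, (hc X).ι_map, Category.assoc, hproj Y _ q hq]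
          exact q.naturality f
        have h2 := key (le_max_left n m)
        rw [← (c X).w (homOfLE (le_max_right n m)), Category.assoc, Category.assoc]
        exact congrArg _ h2 }
  refine ⟨κ, p, fun n => ⟨LCFunctor.hom_ext fun X => ((hc X).proj_isEPPair n).1,
    fun X => ((hc X).proj_isEPPair n).2⟩, fun m n hmn X => (hc X).monotone_proj hmn, ?_, ?_⟩
  · rintro _ ⟨n, rfl⟩ X
    exact ((hc X).proj_isEPPair n).2
  · intro α hα X
    refine (hc X).isLUB_proj.2 ?_
    rintro _ ⟨n, rfl⟩
    exact hα ⟨n, rfl⟩ X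

instance [h : SupportsCanonicalFixedPoints C] : SupportsCanonicalFixedPoints (B ⥤ₒ C) where
  hasInitial := hasInitial_lcFunctor h.hasInitial
  strict := strict_lcFunctor h.strict
  cocomplete := oCocomplete_lcFunctor h.cocomplete

end FunctorCFP

end OCat

/-!
`F† d` carries an initial algebra of `F(d, -)`, with structure map natural in `d`, and two such
families of initial algebras are naturally isomorphic. Each identity therefore amounts to
recognising its other side as a family of initial algebras of the same functor. Parameter:
reindexing. Composition: the rolling rule, `μ (G ∘ F) ≅ G (μ (F ∘ G))`. Double dagger: the diagonal
rule, `μ x. μ y. F(x, y) ≅ μ x. F(x, x)`. Abstraction: pointwise initial algebras are initial in the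
functor category, by naturality of the unique algebra morphism in the parameter.

Powers need more than initiality: an algebra `x : Hⁿ⁺¹ X ⟶ X` is unfolded to the family `Hⁱ X` with
maps `H (Hⁿ X) ⟶ X` and `𝟙 : H (Hⁱ X) ⟶ Hⁱ⁺¹ X`, and the colimit `FIX H` solves every system of
equations `H f_{σ i} ≫ a i = str ≫ f_i` uniquely. Initiality is the case of a single equation.
-/

namespace OCat

open Endofunctor (Algebra)
open scoped CategoryTheory.Prod

section InitialAlgebra

variable {K : Type u₁} [Category.{v₁} K] {H : K ⥤ K} {A : Algebra H}

theorem existsUnique_of_isInitial (h : IsInitial A) {X : K} (x : H.obj X ⟶ X) :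
    ∃! f : A.a ⟶ X, H.map f ≫ x = A.str ≫ f :=
  ⟨(h.to ⟨X, x⟩).f, (h.to ⟨X, x⟩).h, fun f hf =>
    congrArg Algebra.Hom.f (h.hom_ext (Y := ⟨X, x⟩) ⟨f, hf⟩ _)⟩

/-- An algebra with exactly one morphism to every algebra is initial. -/
noncomputable def isInitialOfExistsUnique
    (h : ∀ {X : K} (x : H.obj X ⟶ X), ∃! f : A.a ⟶ X, H.map f ≫ x = A.str ≫ f) : IsInitial A :=
  IsInitial.ofUniqueHom (fun B => ⟨(h B.str).choose, (h B.str).choose_spec.1⟩)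
    fun B m => Algebra.ext ((h B.str).unique m.h (h B.str).choose_spec.1)

/-- The rolling rule: an initial algebra of `F ∘ G` yields one of `G ∘ F`. -/
noncomputable def isInitialRoll {L : Type u₂} [Category.{v₂} L] {F : K ⥤ L} {G : L ⥤ K}
    {T : Algebra (G ⋙ F)} (h : IsInitial T) :
    IsInitial (⟨G.obj T.a, G.map T.str⟩ : Algebra (F ⋙ G)) :=
  isInitialOfExistsUnique fun {X} x => by
    let t : T ⟶ ⟨F.obj X, F.map x⟩ := h.to _
    have ht : F.map (G.map t.f) ≫ F.map x = T.str ≫ t.f := t.h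
    refine ⟨G.map t.f ≫ x, ?_, fun f hf => ?_⟩
    · change G.map (F.map (G.map t.f ≫ x)) ≫ x = G.map T.str ≫ G.map t.f ≫ x
      rw [F.map_comp, ht, G.map_comp, Category.assoc]
    · replace hf : G.map (F.map f) ≫ x = G.map T.str ≫ f := hf
      let inv := Algebra.Initial.strInv h
      have right_inv : T.str ≫ inv = 𝟙 _ := Algebra.Initial.right_inv h
      have left_inv : G.map inv ≫ G.map T.str = 𝟙 _ := by
        rw [← G.map_comp, Algebra.Initial.left_inv h, G.map_id]
      have hGF : G.map inv ≫ G.map (F.map f) ≫ x = f := by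
        rw [hf, reassoc_of% left_inv]
      have hFf : F.map (G.map (inv ≫ F.map f)) ≫ F.map x = T.str ≫ inv ≫ F.map f := by
        rw [reassoc_of% right_inv, ← F.map_comp, G.map_comp, Category.assoc, hGF]
      have hut : inv ≫ F.map f = t.f :=
        (existsUnique_of_isInitial h (X := F.obj X) (F.map x)).unique hFf ht
      rw [← hut, G.map_comp, Category.assoc, hGF]

end InitialAlgebra

section Parametrized

variable {D : Type u₁} [Category.{v₁} D] {K : Type u₂} [Category.{v₂} K]

theorem map_mkHom_comp_assoc {L : Type u₃} [Category.{v₃} L] (F : D × K ⥤ L)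
    {d d' d'' : D} {x x' x'' : K} (f : d ⟶ d') (f' : d' ⟶ d'') (g : x ⟶ x') (g' : x' ⟶ x'')
    {z : L} (h : F.obj (d'', x'') ⟶ z) :
    F.map (f ×ₘ g) ≫ F.map (f' ×ₘ g') ≫ h = F.map ((f ≫ f') ×ₘ (g ≫ g')) ≫ h :=
  (F.map_comp_assoc _ _ _).symm

theorem isIso_map_mkHom {L : Type u₃} [Category.{v₃} L] (F : D × K ⥤ L) (d : D) {x x' : K}
    (g : x ⟶ x') [IsIso g] : IsIso (F.map (𝟙 d ×ₘ g)) :=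
  have : IsIso (𝟙 d ×ₘ g) := (isIso_prod_iff D K).2 ⟨inferInstance, inferInstance⟩
  inferInstance

/-- An initial algebra `F(d, T d) ⟶ T d` of each endofunctor `F(d, -)`, natural in `d`. -/
structure ParamInitialAlgebra (F : D × K ⥤ K) (T : D ⥤ K) where
  /-- The structure maps. -/
  str : (𝟭 D).prod' T ⋙ F ⟶ T
  /-- Initiality in the second argument of `F`. -/
  isInitial (d : D) : IsInitial (⟨T.obj d, str.app d⟩ : Algebra (CategoryTheory.Prod.sectR d K ⋙ F))

namespace ParamInitialAlgebra

variable {F : D × K ⥤ K} {T : D ⥤ K} (α : ParamInitialAlgebra F T)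

theorem str_naturality {d d' : D} (g : d ⟶ d') :
    F.map (g ×ₘ T.map g) ≫ α.str.app d' = α.str.app d ≫ T.map g :=
  α.str.naturality g

theorem existsUnique {d : D} {X : K} (x : F.obj (d, X) ⟶ X) :
    ∃! f : T.obj d ⟶ X, F.map (𝟙 d ×ₘ f) ≫ x = α.str.app d ≫ f :=
  existsUnique_of_isInitial (α.isInitial d) (X := X) x

instance isIso_str_app (d : D) : IsIso (α.str.app d) :=
  Algebra.Initial.str_isIso (α.isInitial d)

/-- A morphism `g : d ⟶ d'` sends the algebra `x'` to the `F(d, -)`-algebra `F(g, 𝟙) ≫ x'`,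
through which both composites are the unique morphism. -/
theorem map_comp_eq_comp {d d' : D} (g : d ⟶ d') {X X' : K} {x : F.obj (d, X) ⟶ X}
    {x' : F.obj (d', X') ⟶ X'} {k : X ⟶ X'} (hk : F.map (g ×ₘ k) ≫ x' = x ≫ k)
    {u : T.obj d ⟶ X} {u' : T.obj d' ⟶ X'} (hu : F.map (𝟙 d ×ₘ u) ≫ x = α.str.app d ≫ u)
    (hu' : F.map (𝟙 d' ×ₘ u') ≫ x' = α.str.app d' ≫ u') : T.map g ≫ u' = u ≫ k := by
  refine (α.existsUnique (F.map (g ×ₘ 𝟙 X') ≫ x')).unique ?_ ?_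
  · rw [← Category.assoc (α.str.app d), ← α.str_naturality, Category.assoc, ← hu',
      map_mkHom_comp_assoc, map_mkHom_comp_assoc]
    simp only [Category.comp_id, Category.id_comp]
  · rw [← Category.assoc (α.str.app d), ← hu, Category.assoc, ← hk, map_mkHom_comp_assoc,
      map_mkHom_comp_assoc]
    simp only [Category.comp_id, Category.id_comp]

section Map

variable {G : D × K ⥤ K} {S : D ⥤ K}

/-- The unique morphism out of an initial algebra. -/
noncomputable def desc {d : D} {X : K} (x : F.obj (d, X) ⟶ X) : T.obj d ⟶ X :=
  (α.existsUnique x).choose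

theorem map_desc {d : D} {X : K} (x : F.obj (d, X) ⟶ X) :
    F.map (𝟙 d ×ₘ α.desc x) ≫ x = α.str.app d ≫ α.desc x :=
  (α.existsUnique x).choose_spec.1

/-- The action of taking parametrized initial algebras on natural transformations. -/
noncomputable def map (η : F ⟶ G) (β : ParamInitialAlgebra G S) : T ⟶ S where
  app d := α.desc (η.app (d, S.obj d) ≫ β.str.app d)
  naturality d d' g := by
    refine α.map_comp_eq_comp g ?_ (α.map_desc _) (α.map_desc _)
    rw [η.naturality_assoc, str_naturality, Category.assoc]

theorem map_app_comp_str (η : F ⟶ G) (β : ParamInitialAlgebra G S) (d : D) :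
    F.map (𝟙 d ×ₘ (α.map η β).app d) ≫ η.app (d, S.obj d) ≫ β.str.app d =
      α.str.app d ≫ (α.map η β).app d :=
  α.map_desc _

theorem eq_map {η : F ⟶ G} {β : ParamInitialAlgebra G S} {t : T ⟶ S}
    (ht : ∀ d, F.map (𝟙 d ×ₘ t.app d) ≫ η.app (d, S.obj d) ≫ β.str.app d =
      α.str.app d ≫ t.app d) : t = α.map η β :=
  NatTrans.ext <| funext fun d => (α.existsUnique _).unique (ht d) (α.map_desc _)

theorem map_id : α.map (𝟙 F) α = 𝟙 T :=
  (α.eq_map fun d => by simp [← prod_id]).symm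

theorem map_comp_map {M : D × K ⥤ K} {R : D ⥤ K} (η : F ⟶ G) (β : ParamInitialAlgebra G S)
    (θ : G ⟶ M) (γ : ParamInitialAlgebra M R) : α.map η β ≫ β.map θ γ = α.map (η ≫ θ) γ := by
  refine α.eq_map fun d => ?_
  rw [NatTrans.comp_app, NatTrans.comp_app, ← Category.assoc (α.str.app d), ← α.map_app_comp_str,
    Category.assoc, Category.assoc, Category.assoc, ← β.map_app_comp_str, ← η.naturality_assoc,
    map_mkHom_comp_assoc, Category.comp_id]

/-- Parametrized initial algebras of the same functor are naturally isomorphic. -/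
@[simps]
noncomputable def iso {S : D ⥤ K} (β : ParamInitialAlgebra F S) : T ≅ S where
  hom := α.map (𝟙 F) β
  inv := β.map (𝟙 F) α
  hom_inv_id := by rw [map_comp_map, Category.comp_id, map_id]
  inv_hom_id := by rw [map_comp_map, Category.comp_id, map_id]

theorem map_comp_iso_hom {η : F ⟶ G} {β : ParamInitialAlgebra G S} {T' S' : D ⥤ K}
    (α' : ParamInitialAlgebra F T') (β' : ParamInitialAlgebra G S') :
    α.map η β ≫ (β.iso β').hom = (α.iso α').hom ≫ α'.map η β' := by
  simp only [iso_hom, map_comp_map, Category.comp_id, Category.id_comp]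

end Map

section Conway

variable {A : Type u₁} [Category.{v₁} A] {B : Type u₂} [Category.{v₂} B] {C : Type u₃}
  [Category.{v₃} C]

/-- Reindexing a parametrized initial algebra along a functor between the parameters. -/
noncomputable def reindex {F : B × C ⥤ C} {T : B ⥤ C} (α : ParamInitialAlgebra F T) (G : A ⥤ B) :
    ParamInitialAlgebra (G.prod (𝟭 C) ⋙ F) (G ⋙ T) where
  str :=
    { app := fun a => α.str.app (G.obj a)
      naturality := fun _ _ g => α.str_naturality (G.map g) }
  isInitial a := isInitialOfExistsUnique fun {X} x => by
    change ∃! f : T.obj (G.obj a) ⟶ X, F.map (G.map (𝟙 a) ×ₘ f) ≫ x = α.str.app (G.obj a) ≫ f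
    rw [G.map_id]
    exact α.existsUnique x

/-- The parametrized rolling rule. -/
noncomputable def roll {P : Type u₃} [Category.{v₃} P] {F : P × A ⥤ B} {G : P × B ⥤ A} {T : P ⥤ B}
    (α : ParamInitialAlgebra ((CategoryTheory.Prod.fst P B).prod' G ⋙ F) T) :
    ParamInitialAlgebra ((CategoryTheory.Prod.fst P A).prod' F ⋙ G) ((𝟭 P).prod' T ⋙ G) where
  str :=
    { app := fun p => G.map (𝟙 p ×ₘ α.str.app p)
      naturality := fun p q g => by
        have h : F.map (g ×ₘ G.map (g ×ₘ T.map g)) ≫ α.str.app q = α.str.app p ≫ T.map g :=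
          α.str_naturality g
        change G.map (g ×ₘ F.map (g ×ₘ G.map (g ×ₘ T.map g))) ≫ G.map (𝟙 q ×ₘ α.str.app q) =
          G.map (𝟙 p ×ₘ α.str.app p) ≫ G.map (g ×ₘ T.map g)
        rw [← G.map_comp, ← G.map_comp]
        simp [h] }
  isInitial p :=
    isInitialRoll (F := CategoryTheory.Prod.sectR p A ⋙ F)
      (G := CategoryTheory.Prod.sectR p B ⋙ G) (α.isInitial p)

theorem map_diag_comp_eq_iff {F : B × B ⥤ B} {S : B ⥤ B} (σ : ParamInitialAlgebra F S) {T X : B}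
    (τ : S.obj T ≅ T) (x : F.obj (X, X) ⟶ X) (f : T ⟶ X) :
    F.map (f ×ₘ f) ≫ x = (F.map (𝟙 T ×ₘ τ.inv) ≫ σ.str.app T ≫ τ.hom) ≫ f ↔
      S.map f ≫ σ.desc x = τ.hom ≫ f := by
  have hS : F.map (f ×ₘ (S.map f ≫ σ.desc x)) ≫ x = σ.str.app T ≫ S.map f ≫ σ.desc x := by
    rw [← reassoc_of% σ.str_naturality f, ← σ.map_desc, map_mkHom_comp_assoc, Category.comp_id]
  constructor
  · intro hf
    have hτ : F.map (f ×ₘ (τ.hom ≫ f)) ≫ x = σ.str.app T ≫ τ.hom ≫ f := by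
      calc F.map (f ×ₘ (τ.hom ≫ f)) ≫ x = F.map (𝟙 T ×ₘ τ.hom) ≫ F.map (f ×ₘ f) ≫ x := by
            rw [map_mkHom_comp_assoc, Category.id_comp]
        _ = σ.str.app T ≫ τ.hom ≫ f := by
            rw [hf, Category.assoc, map_mkHom_comp_assoc, τ.hom_inv_id, Category.id_comp, ← prod_id,
              F.map_id, Category.id_comp, Category.assoc]
    -- `T` is kept as a parameter: both sides are algebra morphisms into `F(f, 𝟙) ≫ x`.
    refine (σ.existsUnique (F.map (f ×ₘ 𝟙 X) ≫ x)).unique ?_ ?_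
    · rw [map_mkHom_comp_assoc, Category.id_comp, Category.comp_id, hS]
    · rw [map_mkHom_comp_assoc, Category.id_comp, Category.comp_id, hτ]
  · intro hf
    rw [Category.assoc, Category.assoc, ← hf, ← hS, map_mkHom_comp_assoc, hf, τ.inv_hom_id_assoc,
      Category.id_comp]

/-- The diagonal rule: an initial algebra of `x ↦ μ y. F(x, y)` yields one of `x ↦ F(x, x)`. -/
noncomputable def isInitialDiag {F : B × B ⥤ B} {S : B ⥤ B} (σ : ParamInitialAlgebra F S) {T : B}
    (τ : S.obj T ≅ T) (hτ : IsInitial (⟨T, τ.hom⟩ : Algebra S)) :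
    IsInitial (⟨T, F.map (𝟙 T ×ₘ τ.inv) ≫ σ.str.app T ≫ τ.hom⟩ : Algebra (Functor.diag B ⋙ F)) :=
  isInitialOfExistsUnique fun x =>
    (existsUnique_congr (map_diag_comp_eq_iff σ τ x)).2 (existsUnique_of_isInitial hτ (σ.desc x))

/-- The structure maps as isomorphisms. -/
noncomputable def strIso {F : A × B ⥤ B} {T : A ⥤ B} (α : ParamInitialAlgebra F T) :
    (𝟭 A).prod' T ⋙ F ≅ T :=
  have := NatIso.isIso_of_isIso_app α.str
  asIso α.str

/-- The parametrized diagonal rule. -/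
noncomputable def diag {F : A × (B × B) ⥤ B} {S : A × B ⥤ B} {T : A ⥤ B}
    (σ : ParamInitialAlgebra (prod.associator A B B ⋙ F) S) (τ : ParamInitialAlgebra S T) :
    ParamInitialAlgebra ((𝟭 A).prod (Functor.diag B) ⋙ F) T where
  str :=
    { app := fun a =>
        F.map (𝟙 a ×ₘ (𝟙 (T.obj a) ×ₘ τ.strIso.inv.app a)) ≫ σ.str.app (a, T.obj a) ≫ τ.str.app a
      naturality := fun a a' g => by
        let s : ∀ a, F.obj (a, (T.obj a, S.obj (a, T.obj a))) ⟶ S.obj (a, T.obj a) :=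
          fun a => σ.str.app (a, T.obj a)
        let t : ∀ a, S.obj (a, T.obj a) ⟶ T.obj a := τ.str.app
        let t' : ∀ a, T.obj a ⟶ S.obj (a, T.obj a) := τ.strIso.inv.app
        have hs : F.map (g ×ₘ (T.map g ×ₘ S.map (g ×ₘ T.map g))) ≫ s a' =
          s a ≫ S.map (g ×ₘ T.map g) := σ.str_naturality (g ×ₘ T.map g)
        have ht : S.map (g ×ₘ T.map g) ≫ t a' = t a ≫ T.map g := τ.str_naturality g
        have ht' : T.map g ≫ t' a' = t' a ≫ S.map (g ×ₘ T.map g) := τ.strIso.inv.naturality g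
        calc F.map (g ×ₘ (T.map g ×ₘ T.map g)) ≫ F.map (𝟙 a' ×ₘ (𝟙 (T.obj a') ×ₘ t' a')) ≫
              s a' ≫ t a'
          _ = F.map (𝟙 a ×ₘ (𝟙 (T.obj a) ×ₘ t' a)) ≫
                F.map (g ×ₘ (T.map g ×ₘ S.map (g ×ₘ T.map g))) ≫ s a' ≫ t a' := by
            simp only [map_mkHom_comp_assoc, prod_comp, ht', Category.comp_id, Category.id_comp]
          _ = (F.map (𝟙 a ×ₘ (𝟙 (T.obj a) ×ₘ t' a)) ≫ s a ≫ t a) ≫ T.map g := by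
            rw [reassoc_of% hs, ht, Category.assoc, Category.assoc] }
  isInitial a :=
    isInitialDiag (σ.reindex (CategoryTheory.Prod.sectR a B)) (τ.strIso.app a) (τ.isInitial a)

end Conway

section Abstraction

open LCFunctor

variable {A : Type u₁} [Category.{v₁} A] [OCategory A] {B : Type u₂} [Category.{v₂} B]
  [OCategory B] {C : Type u₃} [Category.{v₃} C] [OCategory C]

/-- The functor `(a, H) ↦ (b ↦ F(a, b, H b))`. -/
abbrev absFunctor (F : A × (B × C) ⥤ₒ C) : A × (B ⥤ₒ C) ⥤ₒ (B ⥤ₒ C) :=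
  ((assoc A (B ⥤ₒ C) B).comp
    ((prodMap (LCFunctor.id A) (pair (snd (B ⥤ₒ C) B) (ev B C))).comp F)).curry

theorem absFunctor_obj_map (F : A × (B × C) ⥤ₒ C) (a : A) (H : B ⥤ₒ C) {b b' : B} (h : b ⟶ b') :
    ((absFunctor F).obj (a, H)).map h = F.map (𝟙 a ×ₘ (h ×ₘ H.map h)) :=
  congrArg (fun k => F.map (𝟙 a ×ₘ (h ×ₘ k))) (Category.comp_id (H.map h))

theorem absFunctor_map_app (F : A × (B × C) ⥤ₒ C) {a a' : A} (g : a ⟶ a') {H H' : B ⥤ₒ C}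
    (θ : H ⟶ H') (b : B) :
    ((absFunctor F).map (g ×ₘ θ)).app b = F.map (g ×ₘ (𝟙 b ×ₘ θ.app b)) :=
  congrArg (fun k => F.map (g ×ₘ (𝟙 b ×ₘ k)))
    ((congrArg (· ≫ θ.app b) (H.map_id b)).trans (Category.id_comp _))

/-- Pointwise initial algebras form an initial algebra in the functor category. -/
noncomputable def abstraction {F : A × (B × C) ⥤ₒ C} {T : A × B ⥤ₒ C}
    (α : ParamInitialAlgebra ((assoc A B C).comp F).toFunctor T.toFunctor) :
    ParamInitialAlgebra (absFunctor F).toFunctor T.curry.toFunctor where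
  str :=
    { app := fun a =>
        NatTrans.mk (F := ((absFunctor F).obj (a, T.curry.obj a)).toFunctor)
          (G := (T.curry.obj a).toFunctor) (fun b => α.str.app (a, b)) fun b b' h =>
            (congrArg (· ≫ α.str.app (a, b')) (absFunctor_obj_map F a _ h)).trans
              (α.str_naturality (𝟙 a ×ₘ h))
      naturality := fun a a' g => LCFunctor.hom_ext fun b =>
        (congrArg (· ≫ α.str.app (a', b)) (absFunctor_map_app F g _ b)).trans
          (α.str_naturality (g ×ₘ 𝟙 b)) }
  isInitial a := isInitialOfExistsUnique fun {X} x => by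
    have hX {b b' : B} (h : b ⟶ b') : F.map (𝟙 a ×ₘ (h ×ₘ X.map h)) ≫
        (x.app b' : F.obj (a, (b', X.obj b')) ⟶ X.obj b') = x.app b ≫ X.map h :=
      (congrArg (· ≫ x.app b') (absFunctor_obj_map F a X h)).symm.trans (x.naturality h)
    choose u hu huniq using fun b => α.existsUnique (d := (a, b)) (X := X.obj b) (x.app b)
    let w : T.curry.obj a ⟶ X :=
      NatTrans.mk (F := (T.curry.obj a).toFunctor) (G := X.toFunctor) u fun b b' h =>
        α.map_comp_eq_comp (𝟙 a ×ₘ h) (hX h) (hu b) (hu b')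
    refine ⟨w, LCFunctor.hom_ext fun b => ?_, fun v hv => LCFunctor.hom_ext fun b => huniq b _ ?_⟩
    · exact (congrArg (· ≫ x.app b) (absFunctor_map_app F (𝟙 a) w b)).trans (hu b)
    · exact (congrArg (· ≫ x.app b) (absFunctor_map_app F (𝟙 a) v b)).symm.trans
        (congrArg (fun k : _ ⟶ X => k.app b) hv)

/-- The action of `F ↦ absFunctor F` on natural transformations. -/
abbrev absFunctorMap {F G : A × (B × C) ⥤ₒ C} (η : F ⟶ G) : absFunctor F ⟶ absFunctor G :=
  (precomp C (prodMap (LCFunctor.id A) (pair (snd (B ⥤ₒ C) B) (ev B C))) ⋙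
    precomp C (assoc A (B ⥤ₒ C) B) ⋙ curryFunctor (A × (B ⥤ₒ C)) B C).map η

theorem curryFunctor_map_map {F G : A × (B × C) ⥤ₒ C} (η : F ⟶ G) {T S : A × B ⥤ₒ C}
    (α : ParamInitialAlgebra ((assoc A B C).comp F).toFunctor T.toFunctor)
    (β : ParamInitialAlgebra ((assoc A B C).comp G).toFunctor S.toFunctor) :
    (curryFunctor A B C).map (X := T) (Y := S) (α.map ((precomp C (assoc A B C)).map η) β) =
      α.abstraction.map (absFunctorMap η) β.abstraction := by
  refine α.abstraction.eq_map fun a => LCFunctor.hom_ext fun b => ?_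
  exact (congrArg (· ≫ η.app (a, (b, S.obj (a, b))) ≫ β.str.app (a, b))
    (absFunctor_map_app F (𝟙 a) _ b)).trans
      (α.map_app_comp_str ((precomp C (assoc A B C)).map η) β (a, b))

end Abstraction

end ParamInitialAlgebra

end Parametrized

section OColimit

variable {K : Type u₁} [Category.{v₁} K] [OCategory K] {J : ℕ ⥤ K} {κ : Cocone J}

theorem IsOColimit.existsUnique_desc (hκ : IsOColimit κ) {X : K} (s : ∀ n, J.obj n ⟶ X)
    (hs : ∀ n, J.map (homOfLE (Nat.le_add_right n 1)) ≫ s (n + 1) = s n) :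
    ∃! f : κ.pt ⟶ X, ∀ n, κ.ι.app n ≫ f = s n :=
  let t : J ⟶ (Functor.const ℕ).obj X :=
    NatTrans.ofSequence s fun n => (hs n).trans (Category.comp_id _).symm
  ⟨hκ.med t, hκ.fac t, fun _ hf => hκ.hom_ext fun n => (hf n).trans (hκ.fac t n).symm⟩

theorem LCFunctor.isOColimit_mapCocone {L : Type u₂} [Category.{v₂} L] [OCategory L] (F : K ⥤ₒ L)
    (hκ : IsOColimit κ) : IsOColimit (F.toFunctor.mapCocone κ) := by
  have hmap : (fun n => F.map (hκ.proj n) ≫ F.map (κ.ι.app n)) =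
      fun n => F.map (hκ.proj n ≫ κ.ι.app n) := funext fun n => (F.map_comp _ _).symm
  refine ⟨fun n => F.map (hκ.proj n), fun n => F.map_isEPPair (hκ.proj_isEPPair n), ?_, ?_⟩
  · change Monotone fun n => F.map (hκ.proj n) ≫ F.map (κ.ι.app n)
    exact hmap ▸ (F.lc _ _).monotone.comp hκ.monotone_proj
  · change IsLUB (Set.range fun n => F.map (hκ.proj n) ≫ F.map (κ.ι.app n)) (𝟙 (F.obj κ.pt))
    rw [hmap, ← F.map_id]
    have h := F.lc _ _ (Set.range_nonempty _) hκ.monotone_proj.directed_le.directedOn_range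
      hκ.isLUB_proj
    rwa [← Set.range_comp] at h

end OColimit

namespace FixChoice

variable {K : Type u₁} [Category.{v₁} K] [OCategory K] (c : FixChoice K)

section System

variable (H : K ⥤ₒ K) {I : Type*} {σ : I → I} {X : I → K} (a : ∀ i, H.obj (X (σ i)) ⟶ X i)

/-- The approximations `Hⁿ ⊥ ⟶ X i` to a solution of the system of equations
`H f_{σ i} ≫ a i = str ≫ f_i`. -/
def systemι : ∀ n i, c.iter H n ⟶ X i
  | 0, i => c.isInitial.to (X i)
  | n + 1, i => H.map (systemι n (σ i)) ≫ a i

theorem link_systemι (n : ℕ) (i : I) :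
    c.link H n ≫ c.systemι H a (n + 1) i = c.systemι H a n i := by
  induction n generalizing i with
  | zero => exact c.isInitial.hom_ext _ _
  | succ n ih =>
    change H.map (c.link H n) ≫ H.map (c.systemι H a (n + 1) (σ i)) ≫ a i =
      H.map (c.systemι H a n (σ i)) ≫ a i
    rw [← Category.assoc, ← H.map_comp, ih]

end System

variable [SupportsCanonicalFixedPoints K]

/-- The colimit injection `Hⁿ ⊥ ⟶ FIX H`. -/
def fixι (H : K ⥤ₒ K) (n : ℕ) : c.iter H n ⟶ c.FIX.obj H := (c.fixCocone H).ι.app n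

theorem link_fixι (H : K ⥤ₒ K) (n : ℕ) : c.link H n ≫ c.fixι H (n + 1) = c.fixι H n := by
  have h := (c.fixCocone H).w (homOfLE (Nat.le_add_right n 1))
  simp only [chain, Functor.ofSequence_map_homOfLE_succ] at h
  exact h

theorem fixι_map {H H' : K ⥤ₒ K} (η : H ⟶ H') (n : ℕ) :
    c.fixι H n ≫ c.FIX.map η = c.iterMap η n ≫ c.fixι H' n :=
  (c.isOColimit_fixCocone H).ι_map (c.fixCocone H') (c.chainMap η) n

theorem existsUnique_fixι_comp (H : K ⥤ₒ K) {X : K} (s : ∀ n, c.iter H n ⟶ X)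
    (hs : ∀ n, c.link H n ≫ s (n + 1) = s n) : ∃! f : c.FIX.obj H ⟶ X, ∀ n, c.fixι H n ≫ f = s n :=
  (c.isOColimit_fixCocone H).existsUnique_desc s fun n => by
    simp only [chain, Functor.ofSequence_map_homOfLE_succ]
    exact hs n

theorem existsUnique_map_fixι_comp {L : Type u₂} [Category.{v₂} L] [OCategory L] (F : K ⥤ₒ L)
    (H : K ⥤ₒ K) {X : L} (s : ∀ n, F.obj (c.iter H n) ⟶ X)
    (hs : ∀ n, F.map (c.link H n) ≫ s (n + 1) = s n) :
    ∃! f : F.obj (c.FIX.obj H) ⟶ X, ∀ n, F.map (c.fixι H n) ≫ f = s n :=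
  (F.isOColimit_mapCocone (c.isOColimit_fixCocone H)).existsUnique_desc s fun n => by
    simp only [chain, Functor.comp_map, Functor.ofSequence_map_homOfLE_succ]
    exact hs n

theorem map_fixι_hom_ext {L : Type u₂} [Category.{v₂} L] [OCategory L] (F : K ⥤ₒ L)
    {H : K ⥤ₒ K} {X : L} {f g : F.obj (c.FIX.obj H) ⟶ X}
    (h : ∀ n, F.map (c.fixι H n) ≫ f = F.map (c.fixι H n) ≫ g) : f = g :=
  (F.isOColimit_mapCocone (c.isOColimit_fixCocone H)).hom_ext h

theorem exists_fixStr (H : K ⥤ₒ K) : ∃ str : H.obj (c.FIX.obj H) ⟶ c.FIX.obj H,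
    ∀ n, H.map (c.fixι H n) ≫ str = c.fixι H (n + 1) :=
  (c.existsUnique_map_fixι_comp H H (fun n => c.fixι H (n + 1)) fun n =>
    c.link_fixι H (n + 1)).exists

/-- The structure map `H (FIX H) ⟶ FIX H`. -/
noncomputable def fixStr (H : K ⥤ₒ K) : H.obj (c.FIX.obj H) ⟶ c.FIX.obj H :=
  (c.exists_fixStr H).choose

theorem map_fixι_fixStr (H : K ⥤ₒ K) (n : ℕ) :
    H.map (c.fixι H n) ≫ c.fixStr H = c.fixι H (n + 1) :=
  (c.exists_fixStr H).choose_spec n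

theorem map_fixι_fixStr_comp (H : K ⥤ₒ K) {X : K} (f : c.FIX.obj H ⟶ X) (n : ℕ) :
    H.map (c.fixι H n) ≫ c.fixStr H ≫ f = c.fixι H (n + 1) ≫ f :=
  (Category.assoc _ _ _).symm.trans (congrArg (· ≫ f) (c.map_fixι_fixStr H n))

theorem fixStr_naturality {H H' : K ⥤ₒ K} (η : H ⟶ H') :
    H.map (c.FIX.map η) ≫ η.app (c.FIX.obj H') ≫ c.fixStr H' = c.fixStr H ≫ c.FIX.map η := by
  refine c.map_fixι_hom_ext H fun n => ?_
  have hη : H.map (c.fixι H' n) ≫ η.app (c.FIX.obj H') =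
      η.app (c.iter H' n) ≫ H'.map (c.fixι H' n) := η.naturality _
  calc H.map (c.fixι H n) ≫ H.map (c.FIX.map η) ≫ η.app (c.FIX.obj H') ≫ c.fixStr H'
    _ = H.map (c.iterMap η n) ≫ H.map (c.fixι H' n) ≫ η.app (c.FIX.obj H') ≫ c.fixStr H' := by
      rw [← H.map_comp_assoc, fixι_map, H.map_comp_assoc]
    _ = (H.map (c.iterMap η n) ≫ η.app (c.iter H' n)) ≫ H'.map (c.fixι H' n) ≫ c.fixStr H' := by
      rw [reassoc_of% hη, Category.assoc]
    _ = (H.map (c.iterMap η n) ≫ η.app (c.iter H' n)) ≫ c.fixι H' (n + 1) :=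
      congrArg (_ ≫ ·) (c.map_fixι_fixStr H' n)
    _ = H.map (c.fixι H n) ≫ c.fixStr H ≫ c.FIX.map η :=
      ((c.map_fixι_fixStr_comp H _ n).trans (c.fixι_map η (n + 1))).symm

theorem existsUnique_fixStr_system (H : K ⥤ₒ K) {I : Type*} {σ : I → I} {X : I → K}
    (a : ∀ i, H.obj (X (σ i)) ⟶ X i) :
    ∃! f : ∀ i, c.FIX.obj H ⟶ X i, ∀ i, H.map (f (σ i)) ≫ a i = c.fixStr H ≫ f i := by
  choose f hf huniq using fun i =>
    c.existsUnique_fixι_comp H (fun n => c.systemι H a n i) (c.link_systemι H a · i)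
  refine ⟨f, fun i => c.map_fixι_hom_ext H fun n => ?_, fun g hg => funext fun i => huniq i _ ?_⟩
  · calc H.map (c.fixι H n) ≫ H.map (f (σ i)) ≫ a i
      _ = H.map (c.fixι H n ≫ f (σ i)) ≫ a i := (H.map_comp_assoc _ _ _).symm
      _ = H.map (c.systemι H a n (σ i)) ≫ a i := congrArg (fun k => H.map k ≫ a i) (hf (σ i) n)
      _ = H.map (c.fixι H n) ≫ c.fixStr H ≫ f i :=
        ((c.map_fixι_fixStr_comp H (f i) n).trans (hf i (n + 1))).symm
  · intro n
    induction n generalizing i with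
    | zero => exact c.isInitial.hom_ext _ _
    | succ n ih =>
      refine (c.map_fixι_fixStr_comp H (g i) n).symm.trans ?_
      calc H.map (c.fixι H n) ≫ c.fixStr H ≫ g i
        _ = H.map (c.fixι H n) ≫ H.map (g (σ i)) ≫ a i := congrArg (_ ≫ ·) (hg i).symm
        _ = H.map (c.fixι H n ≫ g (σ i)) ≫ a i := (H.map_comp_assoc _ _ _).symm
        _ = H.map (c.systemι H a n (σ i)) ≫ a i := congrArg (fun k => H.map k ≫ a i) (ih (σ i))

/-- `FIX H` is an initial `H`-algebra. -/
noncomputable def isInitialFixStr (H : K ⥤ₒ K) :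
    IsInitial (⟨c.FIX.obj H, c.fixStr H⟩ : Algebra H.toFunctor) :=
  isInitialOfExistsUnique fun {X} x => by
    obtain ⟨f, hf, huniq⟩ :=
      c.existsUnique_fixStr_system H (I := Unit) (σ := id) (X := fun _ => X) fun _ => x
    exact ⟨f (), hf (), fun g hg => congrFun (huniq (fun _ => g) fun _ => hg) ()⟩

end FixChoice

open LCFunctor

section Dagger

variable {D : Type u₁} [Category.{v₁} D] [OCategory D] {K : Type u₂} [Category.{v₂} K]
  [OCategory K]

/-- Isomorphisms of locally continuous functors are those of the underlying functors. -/
def LCFunctor.isoOfToFunctorIso {T S : D ⥤ₒ K} (i : T.toFunctor ≅ S.toFunctor) : T ≅ S :=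
  ⟨i.hom, i.inv, i.hom_inv_id, i.inv_hom_id⟩

namespace FixChoice

variable [SupportsCanonicalFixedPoints K] (c : FixChoice K)

/-- The dagger is a parametrized initial algebra. -/
noncomputable def daggerAlgebra (F : D × K ⥤ₒ K) :
    ParamInitialAlgebra F.toFunctor (c.dagger F).toFunctor where
  str :=
    { app := fun d => c.fixStr (F.partialApp d)
      naturality := fun d d' g => by
        let s : ∀ d, F.obj (d, (c.dagger F).obj d) ⟶ (c.dagger F).obj d :=
          fun d => c.fixStr (F.partialApp d)
        have h : F.map (𝟙 d ×ₘ (c.dagger F).map g) ≫ F.map (g ×ₘ 𝟙 ((c.dagger F).obj d')) ≫ s d' =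
            s d ≫ (c.dagger F).map g := c.fixStr_naturality (F.curry.map g)
        rw [map_mkHom_comp_assoc, Category.id_comp, Category.comp_id] at h
        exact h }
  isInitial d := c.isInitialFixStr (F.partialApp d)

theorem daggerFunctor_map_eq_map {F G : D × K ⥤ₒ K} (η : F ⟶ G) :
    (c.daggerFunctor D).map η = (c.daggerAlgebra F).map η (c.daggerAlgebra G) :=
  (c.daggerAlgebra F).eq_map (β := c.daggerAlgebra G) (t := (c.daggerFunctor D).map η) fun d =>
    c.fixStr_naturality (((curryFunctor D K K).map η).app d)

end FixChoice

end Dagger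

/-- The abstraction identity. -/
noncomputable def abstractionIso (A : Type u₁) [Category.{v₁} A] [OCategory A] (B : Type u₂)
    [Category.{v₂} B] [OCategory B] (C : Type u₃) [Category.{v₃} C] [OCategory C]
    [SupportsCanonicalFixedPoints C] (c : FixChoice C) (e : FixChoice (B ⥤ₒ C)) :
    precomp C (assoc A B C) ⋙ c.daggerFunctor (A × B) ⋙ curryFunctor A B C ≅
      precomp C (prodMap (LCFunctor.id A) (pair (snd (B ⥤ₒ C) B) (ev B C))) ⋙
        precomp C (assoc A (B ⥤ₒ C) B) ⋙ curryFunctor (A × (B ⥤ₒ C)) B C ⋙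
          e.daggerFunctor A :=
  NatIso.ofComponents
    (fun F => isoOfToFunctorIso <| (c.daggerAlgebra ((assoc A B C).comp F)).abstraction.iso
      (e.daggerAlgebra (ParamInitialAlgebra.absFunctor F)))
    fun {F G} η => by
      have hl : (precomp C (assoc A B C) ⋙ c.daggerFunctor (A × B) ⋙ curryFunctor A B C).map η =
          (c.daggerAlgebra ((assoc A B C).comp F)).abstraction.map
            (ParamInitialAlgebra.absFunctorMap η)
            (c.daggerAlgebra ((assoc A B C).comp G)).abstraction :=
        (congrArg (curryFunctor A B C).map (c.daggerFunctor_map_eq_map _)).trans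
          (ParamInitialAlgebra.curryFunctor_map_map η _ _)
      have hr := e.daggerFunctor_map_eq_map (ParamInitialAlgebra.absFunctorMap η)
      refine (congrArg (· ≫ _) hl).trans (Eq.trans ?_ (congrArg (_ ≫ ·) hr).symm)
      exact ParamInitialAlgebra.map_comp_iso_hom _ _ _

section Power

variable {A : Type u₁} [Category.{v₁} A] [OCategory A] {B : Type u₂} [Category.{v₂} B]
  [OCategory B]

namespace LCFunctor

variable (F : A × B ⥤ₒ B)

/-- The index on which the `i`-th equation of `powerSystem` depends: `n, 0, 1, 2, …`. -/
def powerShift (n : ℕ) : ℕ → ℕ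
  | 0 => n
  | i + 1 => i

/-- The system of `F(a, -)`-algebra equations on the family `Fⁱ(a, X)` that encodes a single
algebra `x : Fⁿ⁺¹(a, X) ⟶ X`. -/
def powerSystem {a : A} {X : B} {n : ℕ} (x : (F.power (n + 1)).obj (a, X) ⟶ X) :
    ∀ i, F.obj (a, (F.power (powerShift n i)).obj (a, X)) ⟶ (F.power i).obj (a, X)
  | 0 => x
  | _ + 1 => 𝟙 _

end LCFunctor

namespace ParamInitialAlgebra

variable {F : A × B ⥤ₒ B} {T : A ⥤ B} (α : ParamInitialAlgebra F.toFunctor T)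

/-- The structure map `Fⁿ(a, T a) ⟶ T a`. -/
def powerStr : ∀ n, (𝟭 A).prod' T ⋙ (F.power n).toFunctor ⟶ T
  | 0 => 𝟙 T
  | n + 1 => Functor.whiskerRight (NatTrans.prod' (𝟙 (𝟭 A)) (powerStr n)) F.toFunctor ≫ α.str

theorem powerStr_succ_app_comp (n : ℕ) (a : A) {X : B} (f : T.obj a ⟶ X) :
    (α.powerStr (n + 1)).app a ≫ f = F.map (𝟙 a ×ₘ (α.powerStr n).app a) ≫ α.str.app a ≫ f :=
  Category.assoc _ _ _

instance isIso_powerStr_app (n : ℕ) (a : A) : IsIso ((α.powerStr n).app a) := by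
  induction n with
  | zero => exact inferInstanceAs (IsIso (𝟙 (T.obj a)))
  | succ n ih =>
    have := isIso_map_mkHom F.toFunctor a ((α.powerStr n).app a)
    exact inferInstanceAs (IsIso (F.map (𝟙 a ×ₘ (α.powerStr n).app a) ≫ α.str.app a))

theorem map_powerStr_comp_eq_iff {n : ℕ} {a : A} {X : B} {g : F.obj (a, T.obj a) ⟶ X}
    {f : T.obj a ⟶ X} : F.map (𝟙 a ×ₘ (α.powerStr n).app a) ≫ g = (α.powerStr (n + 1)).app a ≫ f ↔
      g = α.str.app a ≫ f := by
  have := isIso_map_mkHom F.toFunctor a ((α.powerStr n).app a)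
  rw [powerStr_succ_app_comp]
  exact cancel_epi (F.map (𝟙 a ×ₘ (α.powerStr n).app a))

theorem map_powerStr_comp_map {n : ℕ} {a : A} {X : B} {f : T.obj a ⟶ X}
    {g : T.obj a ⟶ (F.power n).obj (a, X)}
    (h : (α.powerStr n).app a ≫ g = (F.power n).map (𝟙 a ×ₘ f)) :
    F.map (𝟙 a ×ₘ (α.powerStr n).app a) ≫ F.map (𝟙 a ×ₘ g) =
      (F.power (n + 1)).map (𝟙 a ×ₘ f) := by
  rw [← F.map_comp, prod_comp, Category.comp_id, h]
  rfl

theorem powerStr_comp_eq_iff {a : A} {X : B} (f : ∀ n, T.obj a ⟶ (F.power n).obj (a, X)) :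
    (∀ n, (α.powerStr n).app a ≫ f n = (F.power n).map (𝟙 a ×ₘ f 0)) ↔
      ∀ n, F.map (𝟙 a ×ₘ f n) = α.str.app a ≫ f (n + 1) := by
  constructor
  · intro h n
    exact α.map_powerStr_comp_eq_iff.1 ((α.map_powerStr_comp_map (h n)).trans (h (n + 1)).symm)
  · intro h n
    induction n with
    | zero => exact Category.id_comp _
    | succ n ih =>
      exact (α.map_powerStr_comp_eq_iff.2 (h n)).symm.trans (α.map_powerStr_comp_map ih)

theorem powerSystem_iff {a : A} {X : B} {n : ℕ} (x : (F.power (n + 1)).obj (a, X) ⟶ X)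
    (f : ∀ i, T.obj a ⟶ (F.power i).obj (a, X)) :
    (∀ i, F.map (𝟙 a ×ₘ f (powerShift n i)) ≫ F.powerSystem x i = α.str.app a ≫ f i) ↔
      (∀ i, (α.powerStr i).app a ≫ f i = (F.power i).map (𝟙 a ×ₘ f 0)) ∧
        (F.power (n + 1)).map (𝟙 a ×ₘ f 0) ≫ x = (α.powerStr (n + 1)).app a ≫ f 0 := by
  have hzero (h : (α.powerStr n).app a ≫ f n = (F.power n).map (𝟙 a ×ₘ f 0)) :
      F.map (𝟙 a ×ₘ f n) ≫ x = α.str.app a ≫ f 0 ↔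
        (F.power (n + 1)).map (𝟙 a ×ₘ f 0) ≫ x = (α.powerStr (n + 1)).app a ≫ f 0 := by
    have hx : (F.power (n + 1)).map (𝟙 a ×ₘ f 0) ≫ x =
        F.map (𝟙 a ×ₘ (α.powerStr n).app a) ≫ F.map (𝟙 a ×ₘ f n) ≫ x :=
      (congrArg (· ≫ x) (α.map_powerStr_comp_map h)).symm.trans (Category.assoc _ _ _)
    exact α.map_powerStr_comp_eq_iff.symm.trans (Eq.congr_left hx.symm)
  have hsucc (i : ℕ) : F.map (𝟙 a ×ₘ f i) ≫ 𝟙 _ = α.str.app a ≫ f (i + 1) ↔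
      F.map (𝟙 a ×ₘ f i) = α.str.app a ≫ f (i + 1) := by
    rw [Category.comp_id]
  rw [powerStr_comp_eq_iff]
  constructor
  · intro h
    have hf (i : ℕ) := (hsucc i).1 (h (i + 1))
    exact ⟨hf, (hzero ((α.powerStr_comp_eq_iff f).2 hf n)).1 (h 0)⟩
  · rintro ⟨hf, h⟩ (_ | i)
    · exact (hzero ((α.powerStr_comp_eq_iff f).2 hf n)).2 h
    · exact (hsucc i).2 (hf i)

end ParamInitialAlgebra

namespace FixChoice

variable [SupportsCanonicalFixedPoints B] (c : FixChoice B) (F : A × B ⥤ₒ B)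

theorem existsUnique_powerStr {a : A} {X : B} {n : ℕ} (x : (F.power (n + 1)).obj (a, X) ⟶ X) :
    ∃! f : (c.dagger F).obj a ⟶ X, (F.power (n + 1)).map (𝟙 a ×ₘ f) ≫ x =
      ((c.daggerAlgebra F).powerStr (n + 1)).app a ≫ f := by
  let α := c.daggerAlgebra F
  obtain ⟨f, hf, huniq⟩ := c.existsUnique_fixStr_system (F.partialApp a)
    (X := fun i => (F.power i).obj (a, X)) (F.powerSystem x)
  refine ⟨f 0, ((α.powerSystem_iff x f).1 hf).2, fun g hg => ?_⟩
  let g' (i : ℕ) := inv ((α.powerStr i).app a) ≫ (F.power i).map (𝟙 a ×ₘ g)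
  have hg'_zero : g' 0 = g := (IsIso.inv_comp_eq _).2 (Category.id_comp g).symm
  have hg' : ∀ i, (α.powerStr i).app a ≫ g' i = (F.power i).map (𝟙 a ×ₘ g' 0) := fun i =>
    (IsIso.hom_inv_id_assoc _ _).trans
      (congrArg (fun k => (F.power i).map (𝟙 a ×ₘ k)) hg'_zero.symm)
  exact hg'_zero.symm.trans
    (congrFun (huniq g' ((α.powerSystem_iff x g').2 ⟨hg', hg'_zero ▸ hg⟩)) 0)

/-- The dagger of `F` is a parametrized initial algebra of every positive power of `F`. -/
noncomputable def daggerPowerAlgebra (n : ℕ) :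
    ParamInitialAlgebra (F.power (n + 1)).toFunctor (c.dagger F).toFunctor where
  str := (c.daggerAlgebra F).powerStr (n + 1)
  isInitial _ := isInitialOfExistsUnique (c.existsUnique_powerStr F)

end FixChoice

end Power

end OCat

open OCat OCat.LCFunctor in
theorem theorem1 :
    -- parameter identity
    (∀ (A : Type u₁) [Category.{v₁} A] [OCategory A] (B : Type u₂) [Category.{v₂} B] [OCategory B]
      (C : Type u₃) [Category.{v₃} C] [OCategory C] [SupportsCanonicalFixedPoints C]
      (c : FixChoice C) (F : B × C ⥤ₒ C) (G : A ⥤ₒ B),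
      Nonempty (c.dagger ((prodMap G (LCFunctor.id C)).comp F) ≅ G.comp (c.dagger F))) ∧
    -- composition identity (parametrized dinaturality)
    (∀ (P : Type u₁) [Category.{v₁} P] [OCategory P]
      (A : Type u₂) [Category.{v₂} A] [OCategory A] [SupportsCanonicalFixedPoints A]
      (B : Type u₃) [Category.{v₃} B] [OCategory B] [SupportsCanonicalFixedPoints B]
      (a : FixChoice A) (b : FixChoice B) (F : P × A ⥤ₒ B) (G : P × B ⥤ₒ A),
      Nonempty (a.dagger ((pair (fst P A) F).comp G) ≅
        (pair (LCFunctor.id P) (b.dagger ((pair (fst P B) G).comp F))).comp G)) ∧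
    -- double dagger identity
    (∀ (A : Type u₁) [Category.{v₁} A] [OCategory A]
      (B : Type u₂) [Category.{v₂} B] [OCategory B] [SupportsCanonicalFixedPoints B]
      (b : FixChoice B) (F : A × (B × B) ⥤ₒ B),
      Nonempty (b.dagger (b.dagger ((assoc A B B).comp F)) ≅
        b.dagger ((prodMap (LCFunctor.id A)
          (pair (LCFunctor.id B) (LCFunctor.id B))).comp F))) ∧
    -- abstraction identity
    (∀ (A : Type u₁) [Category.{v₁} A] [OCategory A] (B : Type u₂) [Category.{v₂} B] [OCategory B]
      (C : Type u₃) [Category.{v₃} C] [OCategory C] [SupportsCanonicalFixedPoints C]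
      (c : FixChoice C) (e : FixChoice (B ⥤ₒ C)),
      Nonempty
        (precomp C (assoc A B C) ⋙ c.daggerFunctor (A × B) ⋙ curryFunctor A B C ≅
          precomp C (prodMap (LCFunctor.id A) (pair (snd (B ⥤ₒ C) B) (ev B C))) ⋙
            precomp C (assoc A (B ⥤ₒ C) B) ⋙ curryFunctor (A × (B ⥤ₒ C)) B C ⋙
              e.daggerFunctor A)) ∧
    -- power identities
    (∀ (A : Type u₁) [Category.{v₁} A] [OCategory A]
      (B : Type u₂) [Category.{v₂} B] [OCategory B] [SupportsCanonicalFixedPoints B]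
      (b : FixChoice B) (F : A × B ⥤ₒ B) (n : ℕ), 1 < n →
      Nonempty (b.dagger (F.power n) ≅ b.dagger F)) := by
  refine ⟨?parameter, ?composition, ?doubleDagger, ?abstraction, ?power⟩
  case parameter =>
    intro A _ _ B _ _ C _ _ _ c F G
    exact ⟨isoOfToFunctorIso <|
      (c.daggerAlgebra _).iso ((c.daggerAlgebra F).reindex G.toFunctor)⟩
  case composition =>
    intro P _ _ A _ _ _ B _ _ _ a b F G
    exact ⟨isoOfToFunctorIso <| (a.daggerAlgebra ((pair (fst P A) F).comp G)).iso
      (b.daggerAlgebra ((pair (fst P B) G).comp F)).roll⟩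
  case doubleDagger =>
    intro A _ _ B _ _ _ b F
    exact ⟨isoOfToFunctorIso <|
      ((b.daggerAlgebra ((assoc A B B).comp F)).diag (F := F.toFunctor) (b.daggerAlgebra _)).iso
        (b.daggerAlgebra
          ((prodMap (LCFunctor.id A) (pair (LCFunctor.id B) (LCFunctor.id B))).comp F))⟩
  case abstraction =>
    intro A _ _ B _ _ C _ _ _ c e
    exact ⟨abstractionIso A B C c e⟩
  case power =>
    intro A _ _ B _ _ _ b F n hn
    obtain ⟨n, rfl⟩ := Nat.exists_eq_succ_of_ne_zero (Nat.ne_zero_of_lt hn)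
    exact ⟨isoOfToFunctorIso <| (b.daggerAlgebra _).iso (b.daggerPowerAlgebra F n)⟩
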